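/- Let $\boldsymbol{R}_{>0}$ be the multiplicative group of positive real numbers, and let $\Gamma$ be the star-shaped tropical curve obtained by gluing $n \ge 1$ copies of $[0,\infty]$ (the one-point compactification of $[0,\infty)$, with its metric, the point $\infty$ being at infinite distance from every other point) at their points $0$; let $\Gamma_\infty$ be the set of its $n$ points at infinity. Let $\operatorname{Rat}(\Gamma)$ be the semifield of rational functions on $\Gamma$: the constant function $-\infty$ and the continuous maps $\Gamma \to \boldsymbol{R} \cup \{\pm\infty\}$ that are piecewise affine with integer slopes and finitely many pieces and take the values $\pm\infty$ at most at points at infinity, with addition the pointwise maximum and multiplication the pointwise sum, extended by continuity to the points at infinity. Let $\operatorname{Aut}_{\rm semiring}(\operatorname{Rat}(\Gamma))$ be its group of semiring automorphisms, and let $\operatorname{Aut}(\Gamma)$ be the group of automorphisms of $\Gamma$, i.e. of finite harmonic morphisms $\Gamma \to \Gamma$ of degree one. (1) If $n \neq 2$, then $\operatorname{Aut}(\Gamma) \cong S_n$ and $\operatorname{Aut}_{\rm semiring}(\operatorname{Rat}(\Gamma)) \cong \operatorname{Aut}(\Gamma) \times \boldsymbol{R}_{>0}$, where $S_n$ is the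 symmetric group of degree $n$. (2) Let $n = 2$, identify $\Gamma$ with $[-\infty,\infty]$, and let $\iota$ be the inversion $y \mapsto -y$ with respect to $0$. Then $$\operatorname{Aut}(\Gamma) = \langle \{\text{the inversion } y \mapsto 2x - y \text{ with respect to } x \mid x \in \Gamma \setminus \Gamma_\infty\} \rangle \cong \boldsymbol{R} \rtimes \langle \iota \rangle,$$ where $\boldsymbol{R}$ is the additive group of real numbers and $\iota$ acts on it by $a \mapsto -a$, and $$\operatorname{Aut}_{\rm semiring}(\operatorname{Rat}(\Gamma)) \cong \operatorname{Aut}(\Gamma) \rtimes \boldsymbol{R}_{>0},$$ where $r \in \boldsymbol{R}_{>0}$ acts on $\operatorname{Aut}(\Gamma)$ by conjugation with the dilatation $y \mapsto r y$ of $\Gamma$. -/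

import Mathlib

open Set Filter Topology
open scoped ENNReal NNReal

noncomputable section

namespace TropicalStar

/-! ### The star-shaped tropical curve with `n` legs `[0, ∞]` -/

/-- The star obtained by gluing `n` copies of `[0, ∞]` at their points `0`, realised as the union
of the coordinate half-axes in `[0, ∞]ⁿ` with the subspace topology. -/
def StarCurve (n : ℕ) : Type :=
  {x : Fin n → ℝ≥0∞ // ∀ i j, i ≠ j → x i = 0 ∨ x j = 0}

namespace StarCurve

variable {n : ℕ}

instance : TopologicalSpace (StarCurve n) := instTopologicalSpaceSubtype

/-- The distance from the centre of the orthogonal projection of `x` to the `i`-th leg. -/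
def coord (x : StarCurve n) (i : Fin n) : ℝ≥0∞ := x.1 i

/-- The point at distance `t ∈ [0, ∞]` from the centre on the `i`-th leg. -/
def leg (i : Fin n) (t : ℝ≥0∞) : StarCurve n :=
  ⟨Pi.single i t, fun j k h => by
    by_cases hj : j = i
    · right; rw [Pi.single_eq_of_ne]; rintro rfl; exact h hj
    · left; rw [Pi.single_eq_of_ne hj]⟩

/-- The set of finite points, i.e. of the points that are not points at infinity. -/
def finitePoints (n : ℕ) : Set (StarCurve n) := {x | ∀ i, x.coord i ≠ ⊤}

/-- The distance on the star: `|s - t|` for the points at heights `s`, `t` of one leg, `s + t` for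
points of two different legs; a point at infinity is at distance `∞` from every other point. -/
def dist (x y : StarCurve n) : ℝ≥0∞ :=
  ∑ i, ((x.coord i - y.coord i) + (y.coord i - x.coord i))

@[ext] theorem ext {x y : StarCurve n} (h : ∀ i, x.coord i = y.coord i) : x = y :=
  Subtype.ext (funext h)

@[simp] theorem coord_leg_self (i : Fin n) (t : ℝ≥0∞) : (leg i t).coord i = t := by
  simp [coord, leg]

theorem coord_leg_ne {i j : Fin n} (h : j ≠ i) (t : ℝ≥0∞) : (leg i t).coord j = 0 := by
  simp [coord, leg, h]

theorem eq_leg {x : StarCurve n} {i : Fin n} (h : x.coord i ≠ 0) : x = leg i (x.coord i) := by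
  ext j
  by_cases hj : j = i
  · subst hj; simp
  · rw [coord_leg_ne hj]; exact (x.2 j i hj).resolve_right h

theorem exists_leg (hn : 0 < n) (x : StarCurve n) : ∃ i t, x = leg i t := by
  by_cases h : ∃ i, x.coord i ≠ 0
  · obtain ⟨i, hi⟩ := h; exact ⟨i, _, eq_leg hi⟩
  · push Not at h
    refine ⟨⟨0, hn⟩, 0, ?_⟩
    ext j
    rw [h j]
    by_cases hj : j = ⟨0, hn⟩
    · subst hj; simp
    · rw [coord_leg_ne hj]

theorem continuous_coord (i : Fin n) : Continuous fun x : StarCurve n => x.coord i :=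
  (continuous_apply i).comp continuous_subtype_val

theorem continuous_leg (i : Fin n) : Continuous (leg i) :=
  Continuous.subtype_mk (continuous_single (A := fun _ : Fin n => ℝ≥0∞) i) _

instance : T2Space (StarCurve n) := inferInstanceAs (T2Space (Subtype _))

instance : CompactSpace (StarCurve n) := by
  have : IsClosed {x : Fin n → ℝ≥0∞ | ∀ i j, i ≠ j → x i = 0 ∨ x j = 0} := by
    simp only [ofPred_forall]
    refine isClosed_iInter fun i => isClosed_iInter fun j => isClosed_iInter fun _ => ?_
    exact (isClosed_eq (continuous_apply i) continuous_const).union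
      (isClosed_eq (continuous_apply j) continuous_const)
  exact isCompact_iff_compactSpace.1 this.isCompact

theorem leg_mem_finitePoints (i : Fin n) {t : ℝ≥0∞} (ht : t ≠ ⊤) : leg i t ∈ finitePoints n := by
  intro j
  by_cases hj : j = i
  · subst hj; simpa using ht
  · rw [coord_leg_ne hj]; simp

theorem dense_finitePoints : Dense (finitePoints n) := by
  intro x
  by_cases hx : x ∈ finitePoints n
  · exact subset_closure hx
  · simp only [finitePoints, mem_ofPred_eq, not_forall, not_not] at hx
    obtain ⟨i, hi⟩ := hx
    have h : x = leg i ⊤ := by rw [← hi]; exact eq_leg (by simp [hi])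
    rw [h]
    exact mem_closure_of_tendsto
      (((continuous_leg i).tendsto ⊤).comp ENNReal.tendsto_nat_nhds_top)
      (Eventually.of_forall fun k => leg_mem_finitePoints i (by simp))

end StarCurve

/-! ### The rational function semifield -/

open StarCurve

/-- A rational function on the star: a continuous map to `ℝ ∪ {±∞}` that either is constantly `-∞`
or is finite at all finite points and, on every leg, affine with an integer slope on each of
finitely many intervals that cover the leg. -/
def IsRational {n : ℕ} (f : StarCurve n → EReal) : Prop :=
  Continuous f ∧
    ((∀ x, f x = ⊥) ∨
      ((∀ x ∈ finitePoints n, f x ≠ ⊥ ∧ f x ≠ ⊤) ∧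
        ∀ i : Fin n, ∃ P : Set (Set ℝ≥0), P.Finite ∧ ⋃₀ P = univ ∧
          ∀ I ∈ P, I.OrdConnected ∧
            ∃ (m : ℤ) (c : ℝ), ∀ t ∈ I, f (leg i t) = ((m * t + c : ℝ) : EReal)))

/-- `Rat(Γ)` for the star `Γ` with `n` legs. -/
def RatFun (n : ℕ) : Type := {f : StarCurve n → EReal // IsRational f}

namespace RatFun

variable {n : ℕ}

instance : CoeFun (RatFun n) fun _ => StarCurve n → EReal := ⟨Subtype.val⟩

theorem continuous_coe (f : RatFun n) : Continuous f := f.2.1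

theorem eq_of_finitePoints {f g : RatFun n} (h : ∀ x ∈ finitePoints n, f x = g x) : f = g :=
  Subtype.ext (Continuous.ext_on dense_finitePoints f.continuous_coe g.continuous_coe h)

theorem isRational_const (c : EReal) (hc : c ≠ ⊤) : IsRational fun _ : StarCurve n => c := by
  refine ⟨continuous_const, ?_⟩
  induction c with
  | bot => exact Or.inl fun _ => rfl
  | top => exact absurd rfl hc
  | coe c =>
    refine Or.inr ⟨fun x _ => by simp, fun i => ⟨{univ}, by simp, by simp, ?_⟩⟩
    rintro I rfl
    exact ⟨ordConnected_univ, 0, c, by simp⟩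

theorem isRational_max {f g : StarCurve n → EReal} (hf : IsRational f) (hg : IsRational g) :
    IsRational fun x => max (f x) (g x) := by
  refine ⟨hf.1.max hg.1, ?_⟩
  rcases hf.2 with hf' | ⟨hf1, hf2⟩
  · simpa [hf'] using hg.2
  rcases hg.2 with hg' | ⟨hg1, hg2⟩
  · simpa [hg'] using hf.2
  refine Or.inr ⟨fun x hx => ?_, fun i => ?_⟩
  · show max (f x) (g x) ≠ ⊥ ∧ max (f x) (g x) ≠ ⊤
    rcases max_choice (f x) (g x) with h | h <;> rw [h]
    exacts [hf1 x hx, hg1 x hx]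
  · obtain ⟨P, hP, hPu, hPa⟩ := hf2 i
    obtain ⟨Q, hQ, hQu, hQa⟩ := hg2 i
    let le : Set ℝ≥0 := {t | f (leg i t) ≤ g (leg i t)}
    let ge : Set ℝ≥0 := {t | g (leg i t) ≤ f (leg i t)}
    refine ⟨image2 (fun I J => I ∩ J ∩ le) P Q ∪ image2 (fun I J => I ∩ J ∩ ge) P Q,
      (hP.image2 _ hQ).union (hP.image2 _ hQ), ?_, ?_⟩
    · refine eq_univ_of_forall fun t => ?_
      obtain ⟨I, hI, hIt⟩ : t ∈ ⋃₀ P := hPu ▸ mem_univ t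
      obtain ⟨J, hJ, hJt⟩ : t ∈ ⋃₀ Q := hQu ▸ mem_univ t
      rcases le_total (f (leg i t)) (g (leg i t)) with h | h
      · exact ⟨_, Or.inl ⟨I, hI, J, hJ, rfl⟩, ⟨hIt, hJt⟩, h⟩
      · exact ⟨_, Or.inr ⟨I, hI, J, hJ, rfl⟩, ⟨hIt, hJt⟩, h⟩
    · rintro _ (⟨I, hI, J, hJ, rfl⟩ | ⟨I, hI, J, hJ, rfl⟩)
      all_goals
        obtain ⟨hIo, m, c, hIm⟩ := hPa I hI
        obtain ⟨hJo, m', c', hJm⟩ := hQa J hJ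
        have hIJ := hIo.inter hJo
        refine ⟨⟨fun s hs t ht u hu => ⟨hIJ.out hs.1 ht.1 hu, ?_⟩⟩, ?_⟩
      · have h1 := hs.2
        have h2 := ht.2
        have huI := hIJ.out hs.1 ht.1 hu
        have hu1 : (s : ℝ) ≤ u := hu.1
        have hu2 : (u : ℝ) ≤ t := hu.2
        simp only [le, mem_ofPred_eq] at h1 h2 ⊢
        rw [hIm _ hs.1.1, hJm _ hs.1.2, EReal.coe_le_coe_iff] at h1
        rw [hIm _ ht.1.1, hJm _ ht.1.2, EReal.coe_le_coe_iff] at h2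
        rw [hIm _ huI.1, hJm _ huI.2, EReal.coe_le_coe_iff]
        rcases le_total (m : ℝ) m' with h | h
        · nlinarith
        · nlinarith
      · refine ⟨m', c', fun t ht => ?_⟩
        exact (max_eq_right (show f (leg i t) ≤ g (leg i t) from ht.2)).trans (hJm t ht.1.2)
      · have h1 := hs.2
        have h2 := ht.2
        have huI := hIJ.out hs.1 ht.1 hu
        have hu1 : (s : ℝ) ≤ u := hu.1
        have hu2 : (u : ℝ) ≤ t := hu.2
        simp only [ge, mem_ofPred_eq] at h1 h2 ⊢
        rw [hIm _ hs.1.1, hJm _ hs.1.2, EReal.coe_le_coe_iff] at h1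
        rw [hIm _ ht.1.1, hJm _ ht.1.2, EReal.coe_le_coe_iff] at h2
        rw [hIm _ huI.1, hJm _ huI.2, EReal.coe_le_coe_iff]
        rcases le_total (m : ℝ) m' with h | h
        · nlinarith
        · nlinarith
      · refine ⟨m, c, fun t ht => ?_⟩
        exact (max_eq_left (show g (leg i t) ≤ f (leg i t) from ht.2)).trans (hIm t ht.1.1)

/-- The sum of the values of two rational functions, extended from the finite points to the points
at infinity by continuity. -/
def addExt (f g : StarCurve n → EReal) : StarCurve n → EReal :=
  extendFrom (finitePoints n) fun x => f x + g x

theorem tendsto_affine (m : ℤ) (c : ℝ) :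
    ∃ y : EReal, Tendsto (fun t : ℝ => ((m * t + c : ℝ) : EReal)) atTop (𝓝 y) := by
  rcases lt_trichotomy (m : ℝ) 0 with h | h | h
  · refine ⟨⊥, EReal.tendsto_coe_atBot.comp ?_⟩
    exact tendsto_atBot_add_const_right _ _ (tendsto_id.const_mul_atTop_of_neg h)
  · exact ⟨c, by simp [h]⟩
  · refine ⟨⊤, EReal.tendsto_coe_atTop.comp ?_⟩
    exact tendsto_atTop_add_const_right _ _ (tendsto_id.const_mul_atTop h)

theorem exists_tail {P : Set (Set ℝ≥0)} (hP : P.Finite) (hu : ⋃₀ P = univ)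
    (ho : ∀ I ∈ P, I.OrdConnected) : ∃ I ∈ P, ∃ T, Ici T ⊆ I := by
  have : ∃ I ∈ P, ¬ BddAbove I := by
    by_contra! h
    have h2 : BddAbove (⋃₀ P) := by rw [sUnion_eq_biUnion]; exact (hP.bddAbove_biUnion).2 h
    rw [hu] at h2
    exact not_bddAbove_univ h2
  obtain ⟨I, hI, hb⟩ := this
  obtain ⟨T, hT⟩ : I.Nonempty := by
    by_contra h
    rw [not_nonempty_iff_eq_empty] at h
    simp [h] at hb
  refine ⟨I, hI, T, fun t ht => ?_⟩
  obtain ⟨s, hs, hts⟩ := not_bddAbove_iff.1 hb t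
  exact (ho I hI).out hT hs ⟨ht, hts.le⟩

theorem isRational_addExt {f g : StarCurve n → EReal} (hf : IsRational f) (hg : IsRational g) :
    IsRational (addExt f g) ∧ ∀ x ∈ finitePoints n, addExt f g x = f x + g x := by
  have bot_case : (∀ x, f x + g x = ⊥) →
      IsRational (addExt f g) ∧ ∀ x ∈ finitePoints n, addExt f g x = f x + g x := by
    intro h
    have : addExt f g = fun _ => ⊥ := by
      funext x
      refine extendFrom_eq (dense_finitePoints x) ?_
      simp only [h]
      exact tendsto_const_nhds
    rw [this]
    exact ⟨isRational_const ⊥ (by simp), fun x _ => (h x).symm⟩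
  rcases hf.2 with hf' | ⟨hf1, hf2⟩
  · exact bot_case fun x => by simp [hf']
  rcases hg.2 with hg' | ⟨hg1, hg2⟩
  · exact bot_case fun x => by simp [hg']
  have hfin : ∀ x ∈ finitePoints n,
      Tendsto (fun x => f x + g x) (𝓝[finitePoints n] x) (𝓝 (f x + g x)) := by
    intro x hx
    have h1 : ContinuousAt (fun p : EReal × EReal => p.1 + p.2) (f x, g x) :=
      EReal.continuousAt_add (Or.inl (hf1 x hx).2) (Or.inl (hf1 x hx).1)
    exact (h1.tendsto.comp ((hf.1.tendsto x).prodMk_nhds (hg.1.tendsto x))).mono_left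
      nhdsWithin_le_nhds
  have hval : ∀ x ∈ finitePoints n, addExt f g x = f x + g x := fun x hx =>
    extendFrom_eq (dense_finitePoints x) (hfin x hx)
  have hpiece : ∀ i : Fin n, ∃ P : Set (Set ℝ≥0), P.Finite ∧ ⋃₀ P = univ ∧
      ∀ I ∈ P, I.OrdConnected ∧
        ∃ (m : ℤ) (c : ℝ), ∀ t ∈ I, f (leg i t) + g (leg i t) = ((m * t + c : ℝ) : EReal) := by
    intro i
    obtain ⟨P, hP, hPu, hPa⟩ := hf2 i
    obtain ⟨Q, hQ, hQu, hQa⟩ := hg2 i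
    refine ⟨image2 (fun I J => I ∩ J) P Q, hP.image2 _ hQ, ?_, ?_⟩
    · refine eq_univ_of_forall fun t => ?_
      obtain ⟨I, hI, hIt⟩ : t ∈ ⋃₀ P := hPu ▸ mem_univ t
      obtain ⟨J, hJ, hJt⟩ : t ∈ ⋃₀ Q := hQu ▸ mem_univ t
      exact ⟨_, ⟨I, hI, J, hJ, rfl⟩, hIt, hJt⟩
    · rintro _ ⟨I, hI, J, hJ, rfl⟩
      obtain ⟨hIo, m, c, hIm⟩ := hPa I hI
      obtain ⟨hJo, m', c', hJm⟩ := hQa J hJ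
      refine ⟨hIo.inter hJo, m + m', c + c', fun t ht => ?_⟩
      rw [hIm t ht.1, hJm t ht.2, ← EReal.coe_add]
      congr 1
      push_cast
      ring
  have hlim : ∀ x, ∃ y, Tendsto (fun x => f x + g x) (𝓝[finitePoints n] x) (𝓝 y) := by
    intro x
    by_cases hx : x ∈ finitePoints n
    · exact ⟨_, hfin x hx⟩
    simp only [finitePoints, mem_ofPred_eq, not_forall, not_not] at hx
    obtain ⟨i, hi⟩ := hx
    obtain ⟨P, hP, hPu, hPa⟩ := hpiece i
    obtain ⟨I, hI, T, hT⟩ := exists_tail hP hPu fun I hI => (hPa I hI).1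
    obtain ⟨-, m, c, hm⟩ := hPa I hI
    obtain ⟨y, hy⟩ := tendsto_affine m c
    refine ⟨y, ?_⟩
    have hc : Tendsto (fun x : StarCurve n => x.coord i) (𝓝[finitePoints n] x) (𝓝 ⊤) := by
      rw [← hi]
      exact ((continuous_coord i).tendsto x).mono_left nhdsWithin_le_nhds
    have hc' : Tendsto (fun x : StarCurve n => (x.coord i).toReal) (𝓝[finitePoints n] x) atTop := by
      refine tendsto_atTop.2 fun b => ?_
      have h1 := hc.eventually (lt_mem_nhds (ENNReal.ofReal_lt_top (r := b)))
      filter_upwards [h1, self_mem_nhdsWithin] with z hz hz'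
      exact (ENNReal.ofReal_le_iff_le_toReal (hz' i)).1 hz.le
    refine (hy.comp hc').congr' ?_
    have h1 := hc.eventually (lt_mem_nhds (ENNReal.coe_lt_top (r := T)))
    filter_upwards [h1, self_mem_nhdsWithin] with z hz hz'
    obtain ⟨t, ht⟩ : ∃ t : ℝ≥0, (t : ℝ≥0∞) = z.coord i :=
      ⟨_, ENNReal.coe_toNNReal (hz' i)⟩
    have hzl : z = leg i t := by rw [ht]; exact eq_leg (pos_of_gt hz).ne'
    have htT : t ∈ I := hT (by rw [← ht] at hz; exact_mod_cast hz.le)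
    simp only [Function.comp]
    rw [← ht, ENNReal.coe_toReal, hzl, hm t htT]
  refine ⟨⟨continuous_extendFrom dense_finitePoints hlim, Or.inr ⟨fun x hx => ?_, fun i => ?_⟩⟩,
    hval⟩
  · rw [hval x hx]
    exact ⟨by simp [EReal.add_eq_bot_iff, hf1 x hx, hg1 x hx],
      EReal.add_ne_top (hf1 x hx).2 (hg1 x hx).2⟩
  · obtain ⟨P, hP, hPu, hPa⟩ := hpiece i
    refine ⟨P, hP, hPu, fun I hI => ⟨(hPa I hI).1, ?_⟩⟩
    obtain ⟨-, m, c, hm⟩ := hPa I hI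
    exact ⟨m, c, fun t ht => by
      rw [hval _ (leg_mem_finitePoints i ENNReal.coe_ne_top), hm t ht]⟩

/-- The tropical sum `f ⊕ g = max f g`. -/
instance : Add (RatFun n) := ⟨fun f g => ⟨fun x => max (f x) (g x), isRational_max f.2 g.2⟩⟩

/-- The tropical product `f ⊙ g = f + g`, extended by continuity to the points at infinity. -/
instance : Mul (RatFun n) := ⟨fun f g => ⟨addExt f g, (isRational_addExt f.2 g.2).1⟩⟩

/-- The zero element is the constant function `-∞`. -/
instance : Zero (RatFun n) := ⟨⟨fun _ => ⊥, isRational_const _ (by simp)⟩⟩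

/-- The identity element is the constant function `0`. -/
instance : One (RatFun n) := ⟨⟨fun _ => 0, isRational_const _ (by simp)⟩⟩

theorem add_apply (f g : RatFun n) (x : StarCurve n) : (f + g) x = max (f x) (g x) := rfl

theorem mul_apply (f g : RatFun n) {x : StarCurve n} (hx : x ∈ finitePoints n) :
    (f * g) x = f x + g x := (isRational_addExt f.2 g.2).2 x hx

theorem zero_apply (x : StarCurve n) : (0 : RatFun n) x = ⊥ := rfl

theorem one_apply (x : StarCurve n) : (1 : RatFun n) x = 0 := rfl

instance : CommSemiring (RatFun n) where
  add_assoc f g h := eq_of_finitePoints fun x _ => by simp only [add_apply, max_assoc]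
  zero_add f := eq_of_finitePoints fun x _ => by simp [add_apply, zero_apply]
  add_zero f := eq_of_finitePoints fun x _ => by simp [add_apply, zero_apply]
  add_comm f g := eq_of_finitePoints fun x _ => by simp only [add_apply, max_comm]
  nsmul := nsmulRec
  left_distrib f g h := eq_of_finitePoints fun x hx => by
    simp only [add_apply, mul_apply _ _ hx, add_max]
  right_distrib f g h := eq_of_finitePoints fun x hx => by
    simp only [add_apply, mul_apply _ _ hx, max_add]
  zero_mul f := eq_of_finitePoints fun x hx => by simp [mul_apply _ _ hx, zero_apply]
  mul_zero f := eq_of_finitePoints fun x hx => by simp [mul_apply _ _ hx, zero_apply]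
  mul_assoc f g h := eq_of_finitePoints fun x hx => by simp only [mul_apply _ _ hx, add_assoc]
  one_mul f := eq_of_finitePoints fun x hx => by simp [mul_apply _ _ hx, one_apply]
  mul_one f := eq_of_finitePoints fun x hx => by simp [mul_apply _ _ hx, one_apply]
  mul_comm f g := eq_of_finitePoints fun x hx => by simp only [mul_apply _ _ hx, add_comm]

end RatFun

/-! ### Models and finite harmonic morphisms -/

namespace StarCurve

/-- A (loopless) model of the star: a finite graph whose vertices are points of the star and whose
edges are subsets of the star identified with intervals `[0, l]`, `0 < l ≤ ∞`. -/
structure Model (n : ℕ) where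
  /-- the vertices -/
  verts : Finset (StarCurve n)
  /-- the edges, as closed subsets of the star -/
  edges : Finset (Set (StarCurve n))
  /-- each edge is identified with `[0, l]`; its vertices are its two distinct ends, and an end at
  infinity is a leaf end -/
  param : ∀ e ∈ edges, ∃ l : ℝ≥0∞, 0 < l ∧ ∃ c : ℝ≥0∞ → StarCurve n,
    ContinuousOn c (Iic l) ∧ c '' Iic l = e ∧
    (∀ s ≤ l, ∀ t ≤ l, dist (c s) (c t) = (s - t) + (t - s)) ∧
    (∀ t ≤ l, c t ∈ verts ↔ t = 0 ∨ t = l) ∧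
    (l = ⊤ → ∀ e' ∈ edges, c l ∈ e' → e' = e)
  /-- the vertices and the edges cover the star -/
  cover : ∀ x, x ∈ verts ∨ ∃ e ∈ edges, x ∈ e
  /-- two different edges meet only in vertices -/
  inter : ∀ e ∈ edges, ∀ e' ∈ edges, e ≠ e' → ∀ x, x ∈ e → x ∈ e' → x ∈ verts

open scoped Classical in
/-- `f` is a finite harmonic morphism of degree `d`. Here `deg e` is the expansion factor of `f` on
the edge `e` and `degAt v` is the degree of `f` at the vertex `v`. -/
def IsFiniteHarmonic {n m : ℕ} (f : StarCurve n → StarCurve m) (d : ℕ) : Prop :=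
  Continuous f ∧ ∃ (M : Model n) (M' : Model m),
    (∀ v ∈ M.verts, f v ∈ M'.verts) ∧
    (∀ e ∈ M.edges, f '' e ∈ M'.edges) ∧
    ∃ deg : Set (StarCurve n) → ℕ,
      (∀ e ∈ M.edges, 0 < deg e ∧
        ∀ x ∈ e, ∀ y ∈ e, dist (f x) (f y) = deg e * dist x y) ∧
      ∃ degAt : StarCurve n → ℕ,
        (∀ v ∈ M.verts, ∀ e' ∈ M'.edges, f v ∈ e' →
          ∑ e ∈ M.edges with f '' e = e' ∧ v ∈ e, deg e = degAt v) ∧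
        ∀ v' ∈ M'.verts, ∑ v ∈ M.verts with f v = v', degAt v = d

/-! #### Automorphisms form a group -/

variable {n m : ℕ}

theorem dist_self (x : StarCurve n) : dist x x = 0 := by simp [dist]

theorem dist_comm (x y : StarCurve n) : dist x y = dist y x := by
  simp only [dist]
  exact Finset.sum_congr rfl fun i _ => add_comm _ _

theorem dist_triangle (x y z : StarCurve n) : dist x z ≤ dist x y + dist y z := by
  simp only [dist, ← Finset.sum_add_distrib]
  refine Finset.sum_le_sum fun i _ => ?_
  have h1 : x.coord i - z.coord i ≤ x.coord i - y.coord i + (y.coord i - z.coord i) :=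
    tsub_le_tsub_add_tsub
  have h2 : z.coord i - x.coord i ≤ z.coord i - y.coord i + (y.coord i - x.coord i) :=
    tsub_le_tsub_add_tsub
  refine (add_le_add h1 h2).trans (le_of_eq ?_)
  ring

theorem eq_of_dist_eq_zero {x y : StarCurve n} (h : dist x y = 0) : x = y := by
  ext i
  simp only [dist, Finset.sum_eq_zero_iff, Finset.mem_univ, true_imp_iff] at h
  have := h i
  rw [add_eq_zero, tsub_eq_zero_iff_le, tsub_eq_zero_iff_le] at this
  exact le_antisymm this.1 this.2

theorem dist_leg (i : Fin n) (s t : ℝ≥0∞) : dist (leg i s) (leg i t) = (s - t) + (t - s) := by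
  rw [dist, Finset.sum_eq_single i]
  · simp
  · intro j _ hj
    simp [coord_leg_ne hj]
  · simp

theorem dist_leg_zero (i : Fin n) (s : ℝ≥0∞) : dist (leg i s) (leg i 0) = s := by
  simp [dist_leg]

theorem dist_leg_ne {i j : Fin n} (h : i ≠ j) (s t : ℝ≥0∞) :
    dist (leg i s) (leg j t) = s + t := by
  rw [dist, Finset.sum_eq_add i j h]
  · simp [coord_leg_ne h, coord_leg_ne h.symm]
  · rintro k _ ⟨h1, h2⟩
    simp [coord_leg_ne h1, coord_leg_ne h2]
  · simp
  · simp

theorem leg_zero (i j : Fin n) : leg i 0 = leg j 0 := by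
  have h : ∀ i k : Fin n, (leg i 0).coord k = 0 := by
    intro i k
    by_cases hk : k = i
    · subst hk; simp
    · exact coord_leg_ne hk _
  ext k
  rw [h, h]

theorem subsingleton_zero (x y : StarCurve 0) : x = y := by
  ext i; exact i.elim0

theorem path_bound (u : ℝ → StarCurve m) (k : ℕ) : ∀ (S : Finset (Set ℝ)), S.card = k →
    ∀ a b : ℝ, a ≤ b → (∀ F ∈ S, IsClosed F) → (∀ s ∈ Icc a b, ∃ F ∈ S, s ∈ F) →
    (∀ F ∈ S, ∀ s ∈ F, ∀ t ∈ F, s ≤ t → dist (u s) (u t) ≤ ENNReal.ofReal (t - s)) →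
    dist (u a) (u b) ≤ ENNReal.ofReal (b - a) := by
  classical
  induction k with
  | zero =>
    intro S hS a b hab _ hcov _
    obtain ⟨F, hF, -⟩ := hcov a ⟨le_rfl, hab⟩
    rw [Finset.card_eq_zero.1 hS] at hF
    simp at hF
  | succ k ih =>
    intro S hS a b hab hcl hcov hu
    obtain ⟨F, hF, haF⟩ := hcov a ⟨le_rfl, hab⟩
    have hcomp : IsCompact (F ∩ Icc a b) := isCompact_Icc.inter_left (hcl F hF)
    obtain ⟨t, ⟨htF, hta, htb⟩, hmax⟩ := hcomp.exists_isMaxOn ⟨a, haF, le_rfl, hab⟩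
      continuousOn_id
    have h1 := hu F hF a haF t htF hta
    rcases htb.eq_or_lt with rfl | htb
    · exact h1
    have hcl' : IsClosed (⋃ G ∈ S.erase F, G) :=
      isClosed_biUnion_finset fun G hG => hcl G (Finset.mem_of_mem_erase hG)
    have hsub : Ioc t b ⊆ ⋃ G ∈ S.erase F, G := by
      intro s hs
      obtain ⟨G, hG, hsG⟩ := hcov s ⟨hta.trans hs.1.le, hs.2⟩
      have : G ≠ F := by
        rintro rfl
        exact absurd (hmax ⟨hsG, hta.trans hs.1.le, hs.2⟩) (not_le.2 hs.1)
      exact mem_biUnion (Finset.mem_coe.2 (Finset.mem_erase.2 ⟨this, hG⟩)) hsG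
    have hsub' : Icc t b ⊆ ⋃ G ∈ S.erase F, G := by
      rw [← closure_Ioc htb.ne]
      exact closure_minimal hsub hcl'
    have h2 := ih (S.erase F) (by rw [Finset.card_erase_of_mem hF, hS]; rfl) t b htb.le
      (fun G hG => hcl G (Finset.mem_of_mem_erase hG))
      (fun s hs => by simpa using hsub' hs)
      (fun G hG => hu G (Finset.mem_of_mem_erase hG))
    calc dist (u a) (u b) ≤ dist (u a) (u t) + dist (u t) (u b) := dist_triangle _ _ _
      _ ≤ ENNReal.ofReal (t - a) + ENNReal.ofReal (b - t) := add_le_add h1 h2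
      _ = ENNReal.ofReal (b - a) := by
        rw [← ENNReal.ofReal_add (by linarith) (by linarith)]
        congr 1
        ring

theorem nonexpanding (h : StarCurve n → StarCurve m) (S : Finset (Set (StarCurve n)))
    (hcl : ∀ e ∈ S, IsClosed e) (hcov : ∀ x, ∃ e ∈ S, x ∈ e)
    (hS : ∀ e ∈ S, ∀ x ∈ e, ∀ y ∈ e, dist (h x) (h y) ≤ dist x y) (x y : StarCurve n) :
    dist (h x) (h y) ≤ dist x y := by
  classical
  rcases Nat.eq_zero_or_pos n with rfl | hn
  · rw [subsingleton_zero x y, dist_self]; exact zero_le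
  have key : ∀ (i : Fin n) (s t : ℝ≥0∞), s ≤ t →
      dist (h (leg i s)) (h (leg i t)) ≤ dist (leg i s) (leg i t) := by
    intro i s t hst
    rcases eq_or_ne s ⊤ with rfl | hs
    · rw [top_le_iff.1 hst, dist_self]; exact zero_le
    rcases eq_or_ne t ⊤ with rfl | ht
    · rw [dist_leg]
      simp [ENNReal.top_sub hs]
    lift s to ℝ≥0 using hs
    lift t to ℝ≥0 using ht
    have hst' : (s : ℝ) ≤ t := by exact_mod_cast hst
    have hc : Continuous fun r : ℝ => leg i (ENNReal.ofReal r) :=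
      (continuous_leg i).comp ENNReal.continuous_ofReal
    have := path_bound (fun r : ℝ => h (leg i (ENNReal.ofReal r))) _
      (S.image fun e => (fun r : ℝ => leg i (ENNReal.ofReal r)) ⁻¹' e) rfl s t hst' ?_ ?_ ?_
    · simp only [ENNReal.ofReal_coe_nnreal] at this
      refine this.trans (le_of_eq ?_)
      rw [dist_leg, tsub_eq_zero_of_le hst, zero_add, ENNReal.ofReal_sub _ (NNReal.coe_nonneg s)]
      simp
    · intro F hF
      obtain ⟨e, he, rfl⟩ := Finset.mem_image.1 hF
      exact (hcl e he).preimage hc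
    · intro r _
      obtain ⟨e, he, hre⟩ := hcov (leg i (ENNReal.ofReal r))
      exact ⟨_, Finset.mem_image_of_mem _ he, hre⟩
    · intro F hF a ha b hb hab
      obtain ⟨e, he, rfl⟩ := Finset.mem_image.1 hF
      refine (hS e he _ ha _ hb).trans ?_
      rw [dist_leg, tsub_eq_zero_of_le (ENNReal.ofReal_le_ofReal hab), zero_add]
      refine tsub_le_iff_right.2 ?_
      calc ENNReal.ofReal b = ENNReal.ofReal (b - a + a) := by congr 1; ring
        _ ≤ _ := ENNReal.ofReal_add_le
  have key' : ∀ (i : Fin n) (s t : ℝ≥0∞),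
      dist (h (leg i s)) (h (leg i t)) ≤ dist (leg i s) (leg i t) := by
    intro i s t
    rcases le_total s t with hst | hst
    · exact key i s t hst
    · rw [dist_comm, dist_comm (leg i s)]; exact key i t s hst
  obtain ⟨i, s, rfl⟩ := exists_leg hn x
  obtain ⟨j, t, rfl⟩ := exists_leg hn y
  by_cases hij : i = j
  · subst hij; exact key' i s t
  calc dist (h (leg i s)) (h (leg j t))
      ≤ dist (h (leg i s)) (h (leg i 0)) + dist (h (leg i 0)) (h (leg j t)) := dist_triangle _ _ _
    _ ≤ s + t := by
      refine add_le_add ((key' i s 0).trans (le_of_eq (dist_leg_zero i s))) ?_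
      rw [leg_zero i j, dist_comm]
      exact (key' j t 0).trans (le_of_eq (dist_leg_zero j t))
    _ = _ := (dist_leg_ne hij s t).symm

theorem preconnected : IsPreconnected (univ : Set (StarCurve n)) := by
  rcases Nat.eq_zero_or_pos n with rfl | hn
  · exact Set.Subsingleton.isPreconnected fun x _ y _ => subsingleton_zero x y
  have : (univ : Set (StarCurve n)) = ⋃ i, range (leg i) := by
    refine (eq_univ_of_forall fun x => ?_).symm
    obtain ⟨i, t, rfl⟩ := exists_leg hn x
    exact mem_iUnion.2 ⟨i, t, rfl⟩
  rw [this]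
  refine isPreconnected_iUnion ⟨leg ⟨0, hn⟩ 0, ?_⟩ fun i =>
    isPreconnected_range (continuous_leg i)
  exact mem_iInter.2 fun i => ⟨0, leg_zero _ _⟩

namespace Model

theorem isClosed_edge (M : Model n) {e : Set (StarCurve n)} (he : e ∈ M.edges) : IsClosed e := by
  obtain ⟨l, -, c, hc, rfl, -⟩ := M.param e he
  exact (isClosed_Iic.isCompact.image_of_continuousOn hc).isClosed

theorem exists_ends (M : Model n) {e : Set (StarCurve n)} (he : e ∈ M.edges) :
    ∃ v ∈ e, ∃ w ∈ e, v ≠ w ∧ ∀ x ∈ e, x ∈ M.verts ↔ x = v ∨ x = w := by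
  obtain ⟨l, hl, c, hc, rfl, hd, hv, -⟩ := M.param e he
  have hinj : ∀ s ≤ l, ∀ t ≤ l, c s = c t → s = t := by
    intro s hs t ht hst
    have h1 := hd s hs t ht
    rw [hst, dist_self, eq_comm, add_eq_zero, tsub_eq_zero_iff_le, tsub_eq_zero_iff_le] at h1
    exact le_antisymm h1.1 h1.2
  refine ⟨c 0, ⟨0, mem_Iic.2 zero_le, rfl⟩, c l, ⟨l, mem_Iic.2 le_rfl, rfl⟩, fun h => ?_, ?_⟩
  · exact hl.ne (hinj 0 zero_le l le_rfl h)
  · rintro _ ⟨t, ht, rfl⟩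
    rw [hv t ht]
    exact or_congr ⟨fun h => by rw [h], hinj t ht 0 zero_le⟩
      ⟨fun h => by rw [h], hinj t ht l le_rfl⟩

theorem exists_edge (M : Model n) (hn : 0 < n) (x : StarCurve n) : ∃ e ∈ M.edges, x ∈ e := by
  classical
  rcases M.cover x with hx | hx
  swap
  · exact hx
  by_contra! hne
  let C : Set (StarCurve n) := (M.verts.erase x : Finset _) ∪ ⋃ e ∈ M.edges, e
  have hC : IsClosed C := (Finset.isClosed _).union
    (isClosed_biUnion_finset fun e he => M.isClosed_edge he)
  have hCx : C = {x}ᶜ := by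
    ext y
    constructor
    · rintro (hy | hy)
      · exact (Finset.mem_erase.1 (Finset.mem_coe.1 hy)).1
      · obtain ⟨e, he, hye⟩ := mem_iUnion₂.1 hy
        rintro rfl
        exact hne e he hye
    · intro hy
      rcases M.cover y with h | ⟨e, he, hye⟩
      · exact Or.inl (Finset.mem_coe.2 (Finset.mem_erase.2 ⟨hy, h⟩))
      · exact Or.inr (mem_iUnion₂.2 ⟨e, he, hye⟩)
  have hopen : IsOpen ({x} : Set (StarCurve n)) := by
    rw [← isClosed_compl_iff, ← hCx]; exact hC
  have : PreconnectedSpace (StarCurve n) := ⟨preconnected⟩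
  rcases isClopen_iff.1 (⟨isClosed_singleton, hopen⟩ : IsClopen ({x} : Set (StarCurve n)))
    with h | h
  · exact singleton_ne_empty x h
  · have h0 : leg ⟨0, hn⟩ 0 ∈ ({x} : Set (StarCurve n)) := h ▸ mem_univ _
    have h1 : leg ⟨0, hn⟩ 1 ∈ ({x} : Set (StarCurve n)) := h ▸ mem_univ _
    have h2 := dist_leg_zero (⟨0, hn⟩ : Fin n) 1
    rw [mem_singleton_iff.1 h0, mem_singleton_iff.1 h1, dist_self] at h2
    exact zero_ne_one h2

end Model

/-- A finite harmonic morphism of degree one from the star to itself is a distance-preserving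
bijection. -/
theorem IsFiniteHarmonic.bijective_and_isometric {f : StarCurve n → StarCurve n}
    (hf : IsFiniteHarmonic f 1) :
    Function.Bijective f ∧ ∀ x y, dist (f x) (f y) = dist x y := by
  classical
  rcases Nat.eq_zero_or_pos n with rfl | hn
  · exact ⟨⟨fun x y _ => subsingleton_zero x y, fun y => ⟨y, subsingleton_zero _ _⟩⟩,
      fun x y => by rw [subsingleton_zero (f x) x, subsingleton_zero (f y) y]⟩
  obtain ⟨-, M, M', hV, hE, deg, hdeg, degAt, hloc, hglob⟩ := hf
  have hdegAt : ∀ v ∈ M.verts, 1 ≤ degAt v := by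
    intro v hv
    obtain ⟨e, he, hve⟩ := M.exists_edge hn v
    rw [← hloc v hv (f '' e) (hE e he) ⟨v, hve, rfl⟩]
    exact (hdeg e he).1.trans_le (Finset.single_le_sum (f := deg) (fun _ _ => Nat.zero_le _)
      (Finset.mem_filter.2 ⟨he, rfl, hve⟩))
  have hinjV : ∀ v ∈ M.verts, ∀ w ∈ M.verts, f v = f w → v = w := by
    intro v hv w hw hvw
    by_contra hne
    have h1 := hglob (f v) (hV v hv)
    have h2 : ∑ u ∈ ({v, w} : Finset _), degAt u ≤ ∑ u ∈ M.verts with f u = f v, degAt u := by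
      refine Finset.sum_le_sum_of_subset ?_
      intro u hu
      rcases Finset.mem_insert.1 hu with rfl | hu
      · exact Finset.mem_filter.2 ⟨hv, rfl⟩
      · rw [Finset.mem_singleton.1 hu]; exact Finset.mem_filter.2 ⟨hw, hvw.symm⟩
    rw [Finset.sum_pair hne, h1] at h2
    have := hdegAt v hv
    have := hdegAt w hw
    omega
  have hdegAt1 : ∀ v ∈ M.verts, degAt v = 1 := by
    intro v hv
    refine le_antisymm ?_ (hdegAt v hv)
    rw [← hglob (f v) (hV v hv)]
    exact Finset.single_le_sum (f := degAt) (fun _ _ => Nat.zero_le _)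
      (Finset.mem_filter.2 ⟨hv, rfl⟩)
  have hsurjV : ∀ v' ∈ M'.verts, ∃ v ∈ M.verts, f v = v' := by
    intro v' hv'
    by_contra! hne
    have := hglob v' hv'
    rw [Finset.filter_false_of_mem hne] at this
    simp at this
  have hdeg1 : ∀ e ∈ M.edges, deg e = 1 := by
    intro e he
    obtain ⟨v, hve, w, -, -, hvw⟩ := M.exists_ends he
    have hv := (hvw v hve).2 (Or.inl rfl)
    refine le_antisymm ?_ (hdeg e he).1
    rw [← hdegAt1 v hv, ← hloc v hv (f '' e) (hE e he) ⟨v, hve, rfl⟩]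
    exact Finset.single_le_sum (f := deg) (fun _ _ => Nat.zero_le _)
      (Finset.mem_filter.2 ⟨he, rfl, hve⟩)
  have hiso : ∀ e ∈ M.edges, ∀ x ∈ e, ∀ y ∈ e, dist (f x) (f y) = dist x y := by
    intro e he x hx y hy
    rw [(hdeg e he).2 x hx y hy, hdeg1 e he, Nat.cast_one, one_mul]
  have hinjE : ∀ e ∈ M.edges, ∀ x ∈ e, ∀ y ∈ e, f x = f y → x = y := by
    intro e he x hx y hy hxy
    refine eq_of_dist_eq_zero ?_
    rw [← hiso e he x hx y hy, hxy, dist_self]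
  have hvert : ∀ e ∈ M.edges, ∀ x ∈ e, f x ∈ M'.verts → x ∈ M.verts := by
    intro e he x hx hfx
    obtain ⟨v, hve, w, hwe, hne, hvw⟩ := M.exists_ends he
    obtain ⟨v', -, w', -, -, hvw'⟩ := M'.exists_ends (hE e he)
    have hv := (hvw' (f v) ⟨v, hve, rfl⟩).1 (hV v ((hvw v hve).2 (Or.inl rfl)))
    have hw := (hvw' (f w) ⟨w, hwe, rfl⟩).1 (hV w ((hvw w hwe).2 (Or.inr rfl)))
    have hx' := (hvw' (f x) ⟨x, hx, rfl⟩).1 hfx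
    have hne' : f v ≠ f w := fun h => hne (hinjE e he v hve w hwe h)
    refine (hvw x hx).2 ?_
    have : f x = f v ∨ f x = f w := by
      clear * - hv hw hx' hne'
      rcases hv with hv | hv
      · rcases hw with hw | hw
        · exact absurd (hv.trans hw.symm) hne'
        · exact hx'.imp (fun h => h.trans hv.symm) fun h => h.trans hw.symm
      · rcases hw with hw | hw
        · exact hx'.symm.imp (fun h => h.trans hv.symm) fun h => h.trans hw.symm
        · exact absurd (hv.trans hw.symm) hne'
    exact this.imp (hinjE e he x hx v hve) (hinjE e he x hx w hwe)
  have hedge : ∀ e₁ ∈ M.edges, ∀ e₂ ∈ M.edges, f '' e₁ = f '' e₂ → e₁ = e₂ := by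
    intro e₁ he₁ e₂ he₂ h
    by_contra hne
    obtain ⟨v, hve, w, -, -, hvw⟩ := M.exists_ends he₁
    have hv := (hvw v hve).2 (Or.inl rfl)
    have hfv : f v ∈ f '' e₂ := h ▸ ⟨v, hve, rfl⟩
    obtain ⟨x, hx, hxv⟩ := hfv
    have hxV := hvert e₂ he₂ x hx (hxv ▸ hV v hv)
    obtain rfl := hinjV x hxV v hv hxv
    have h1 := hloc x hv (f '' e₁) (hE e₁ he₁) ⟨x, hve, rfl⟩
    have h2 : ∑ e ∈ ({e₁, e₂} : Finset _), deg e ≤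
        ∑ e ∈ M.edges with f '' e = f '' e₁ ∧ x ∈ e, deg e := by
      refine Finset.sum_le_sum_of_subset ?_
      intro e he
      rcases Finset.mem_insert.1 he with rfl | he
      · exact Finset.mem_filter.2 ⟨he₁, rfl, hve⟩
      · rw [Finset.mem_singleton.1 he]; exact Finset.mem_filter.2 ⟨he₂, h.symm, hx⟩
    rw [Finset.sum_pair hne, h1, hdegAt1 x hv, hdeg1 e₁ he₁, hdeg1 e₂ he₂] at h2
    omega
  have hsurjE : ∀ e' ∈ M'.edges, ∃ e ∈ M.edges, f '' e = e' := by
    intro e' he'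
    obtain ⟨v', hve', w', -, -, hvw'⟩ := M'.exists_ends he'
    obtain ⟨v, hv, rfl⟩ := hsurjV v' ((hvw' v' hve').2 (Or.inl rfl))
    by_contra! hne
    have := hloc v hv e' he' hve'
    rw [hdegAt1 v hv, Finset.filter_false_of_mem fun e he h => hne e he h.1] at this
    simp at this
  have hbij : Function.Bijective f := by
    refine ⟨fun x y hxy => ?_, fun y => ?_⟩
    · obtain ⟨e₁, he₁, hx⟩ := M.exists_edge hn x
      obtain ⟨e₂, he₂, hy⟩ := M.exists_edge hn y
      by_cases h : e₁ = e₂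
      · subst h; exact hinjE e₁ he₁ x hx y hy hxy
      · have hfx : f x ∈ M'.verts := M'.inter _ (hE e₁ he₁) _ (hE e₂ he₂)
          (fun h' => h (hedge e₁ he₁ e₂ he₂ h')) _ ⟨x, hx, rfl⟩ ⟨y, hy, hxy.symm⟩
        exact hinjV x (hvert e₁ he₁ x hx hfx) y (hvert e₂ he₂ y hy (hxy ▸ hfx)) hxy
    · obtain ⟨e', he', hy⟩ := M'.exists_edge hn y
      obtain ⟨e, -, rfl⟩ := hsurjE e' he'
      obtain ⟨x, -, rfl⟩ := hy
      exact ⟨x, rfl⟩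
  refine ⟨hbij, fun x y => le_antisymm ?_ ?_⟩
  · exact nonexpanding f M.edges (fun e he => M.isClosed_edge he) (M.exists_edge hn)
      (fun e he x hx y hy => (hiso e he x hx y hy).le) x y
  · let g := Equiv.ofBijective f hbij
    have := nonexpanding g.symm M'.edges (fun e he => M'.isClosed_edge he) (M'.exists_edge hn)
      (fun e' he' x hx y hy => ?_) (g x) (g y)
    · rwa [g.symm_apply_apply, g.symm_apply_apply] at this
    · obtain ⟨e, he, rfl⟩ := hsurjE e' he'
      obtain ⟨a, ha, rfl⟩ := hx
      obtain ⟨b, hb, rfl⟩ := hy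
      rw [hiso e he a ha b hb]
      exact le_of_eq (congrArg₂ dist (g.symm_apply_apply a) (g.symm_apply_apply b))

namespace Model

open scoped Classical in
/-- The model whose edges are the legs of the star. -/
def legs (n : ℕ) : Model n where
  verts := insert ⟨0, fun _ _ _ => Or.inl rfl⟩ (Finset.univ.image fun i : Fin n => leg i ⊤)
  edges := Finset.univ.image fun i : Fin n => leg i '' Iic ⊤
  param := by
    intro e he
    obtain ⟨i, -, rfl⟩ := Finset.mem_image.1 he
    have h0 : leg i 0 = ⟨0, fun _ _ _ => Or.inl rfl⟩ := Subtype.ext (Pi.single_zero i)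
    refine ⟨⊤, ENNReal.zero_lt_top, leg i, (continuous_leg i).continuousOn, rfl,
      fun s _ t _ => dist_leg i s t, fun t _ => ?_, fun _ e' he' h => ?_⟩
    · rw [← h0, Finset.mem_insert, Finset.mem_image]
      constructor
      · rintro (h | ⟨j, -, h⟩)
        · left
          simpa using congrArg (fun x => coord x i) h
        · by_cases hij : i = j
          · subst hij
            right
            simpa using (congrArg (fun x => coord x i) h).symm
          · have := congrArg (fun x => coord x j) h
            simp [coord_leg_ne (Ne.symm hij)] at this
      · rintro (rfl | rfl)
        · exact Or.inl rfl
        · exact Or.inr ⟨i, Finset.mem_univ _, rfl⟩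
    · obtain ⟨j, -, rfl⟩ := Finset.mem_image.1 he'
      obtain ⟨t, -, h⟩ := h
      by_cases hij : i = j
      · rw [hij]
      · have := congrArg (fun x => coord x i) h
        simp [coord_leg_ne hij] at this
  cover := by
    intro x
    rcases Nat.eq_zero_or_pos n with rfl | hn
    · exact Or.inl (Finset.mem_insert.2 (Or.inl (subsingleton_zero _ _)))
    · obtain ⟨i, t, rfl⟩ := exists_leg hn x
      exact Or.inr ⟨_, Finset.mem_image_of_mem _ (Finset.mem_univ i), t, mem_Iic.2 le_top, rfl⟩
  inter := by
    intro e he e' he' hne x hx hx'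
    obtain ⟨i, -, rfl⟩ := Finset.mem_image.1 he
    obtain ⟨j, -, rfl⟩ := Finset.mem_image.1 he'
    have hij : i ≠ j := by rintro rfl; exact hne rfl
    obtain ⟨s, -, rfl⟩ := hx
    obtain ⟨t, -, h⟩ := hx'
    have hs : s = 0 := by
      have := congrArg (fun x => coord x i) h
      simpa [coord_leg_ne hij] using this.symm
    rw [hs]
    exact Finset.mem_insert.2 (Or.inl (Subtype.ext (Pi.single_zero i)))

open scoped Classical in
/-- The image of a model under a distance-preserving homeomorphism. -/
def map (M : Model n) (g : Equiv.Perm (StarCurve n)) (hg : Continuous g)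
    (hd : ∀ x y, dist (g x) (g y) = dist x y) : Model n where
  verts := M.verts.image g
  edges := M.edges.image fun e => g '' e
  param := by
    intro e he
    obtain ⟨e, he0, rfl⟩ := Finset.mem_image.1 he
    obtain ⟨l, hl, c, hc, rfl, hcd, hv, hleaf⟩ := M.param e he0
    refine ⟨l, hl, g ∘ c, hg.comp_continuousOn hc, image_comp _ _ _,
      fun s hs t ht => (hd _ _).trans (hcd s hs t ht), fun t ht => ?_, fun hl e' he' h => ?_⟩
    · rw [← hv t ht]
      simp
    · obtain ⟨e', he0', rfl⟩ := Finset.mem_image.1 he'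
      rw [Function.comp, g.injective.mem_set_image] at h
      rw [hleaf hl e' he0' h]
  cover := by
    intro x
    rcases M.cover (g.symm x) with h | ⟨e, he, h⟩
    · exact Or.inl (Finset.mem_image.2 ⟨_, h, g.apply_symm_apply x⟩)
    · exact Or.inr ⟨_, Finset.mem_image_of_mem _ he, _, h, g.apply_symm_apply x⟩
  inter := by
    intro e he e' he' hne x hx hx'
    obtain ⟨e, he0, rfl⟩ := Finset.mem_image.1 he
    obtain ⟨e', he0', rfl⟩ := Finset.mem_image.1 he'
    obtain ⟨x, hx, rfl⟩ := hx
    rw [g.injective.mem_set_image] at hx'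
    exact Finset.mem_image_of_mem _
      (M.inter e he0 e' he0' (fun h => hne (by rw [h])) x hx hx')

end Model

theorem isFiniteHarmonic_of_isometric (g : Equiv.Perm (StarCurve n)) (hg : Continuous g)
    (hd : ∀ x y, dist (g x) (g y) = dist x y) : IsFiniteHarmonic g 1 := by
  classical
  refine ⟨hg, Model.legs n, (Model.legs n).map g hg hd, ?_, ?_, fun _ => 1, ?_, fun _ => 1, ?_, ?_⟩
  · intro v hv
    simpa [Model.map] using hv
  · intro e he
    simp only [Model.map]
    convert Finset.mem_image_of_mem (fun e => g '' e) he
  · intro e _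
    exact ⟨one_pos, fun x _ y _ => by rw [hd, Nat.cast_one, one_mul]⟩
  · intro v hv e' he' hve'
    simp only [Model.map, Finset.mem_image] at he'
    obtain ⟨e, he, rfl⟩ := he'
    rw [g.injective.mem_set_image] at hve'
    rw [Finset.sum_const, smul_eq_mul, mul_one, Finset.card_eq_one]
    refine ⟨e, ?_⟩
    ext e'
    simp only [Finset.mem_filter, Finset.mem_singleton, g.injective.image_injective.eq_iff]
    constructor
    · rintro ⟨-, h, -⟩; exact h
    · rintro rfl; exact ⟨he, rfl, hve'⟩
  · intro v' hv'
    simp only [Model.map, Finset.mem_image] at hv'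
    obtain ⟨v, hv, rfl⟩ := hv'
    rw [Finset.sum_const, smul_eq_mul, mul_one, Finset.card_eq_one]
    refine ⟨v, ?_⟩
    ext w
    simp only [Finset.mem_filter, Finset.mem_singleton, g.injective.eq_iff]
    constructor
    · rintro ⟨-, h⟩; exact h
    · rintro rfl; exact ⟨hv, rfl⟩

/-- `Aut(Γ)` for the star `Γ` with `n` legs: the group, under composition, of the finite harmonic
morphisms `Γ → Γ` of degree one. They are all bijective, see
`IsFiniteHarmonic.bijective_and_isometric`. -/
def Aut (n : ℕ) : Subgroup (Equiv.Perm (StarCurve n)) where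
  carrier := {g | IsFiniteHarmonic g 1}
  mul_mem' {a b} ha hb := isFiniteHarmonic_of_isometric (a * b) (ha.1.comp hb.1) fun x y =>
    (ha.bijective_and_isometric.2 _ _).trans (hb.bijective_and_isometric.2 x y)
  one_mem' := isFiniteHarmonic_of_isometric 1 continuous_id fun _ _ => rfl
  inv_mem' {a} ha := isFiniteHarmonic_of_isometric a⁻¹
    (Continuous.continuous_symm_of_equiv_compact_to_t2 (f := a) ha.1) fun x y => by
      rw [← ha.bijective_and_isometric.2]
      simp

/-! ### The star with two legs as `[-∞, ∞]` -/

/-- The identification of the star with two legs with `[-∞, ∞]`: the leg `0` is `[0, ∞]` and the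
leg `1` is `[-∞, 0]`. -/
def lineEquiv : StarCurve 2 ≃ EReal where
  toFun x := (x.coord 0 : EReal) - (x.coord 1 : EReal)
  invFun y := ⟨![y.toENNReal, (-y).toENNReal], by
    have h : y.toENNReal = 0 ∨ (-y).toENNReal = 0 := by
      rcases le_total y 0 with h | h
      · exact Or.inl (EReal.toENNReal_of_nonpos h)
      · exact Or.inr (EReal.toENNReal_of_nonpos (EReal.neg_le_zero.2 h))
    intro i j hij
    fin_cases i <;> fin_cases j
    · exact absurd rfl hij
    · exact h
    · exact h.symm
    · exact absurd rfl hij⟩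
  left_inv x := by
    have hx : x.coord 0 = 0 ∨ x.coord 1 = 0 := x.2 0 1 (by decide)
    refine ext fun i => ?_
    fin_cases i
    · show (((x.coord 0 : EReal) - (x.coord 1 : EReal)).toENNReal) = x.coord 0
      rcases hx with h | h
      · rw [h, EReal.coe_ennreal_zero, zero_sub]
        exact EReal.toENNReal_of_nonpos (EReal.neg_le_zero.2 (EReal.coe_ennreal_nonneg _))
      · rw [h, EReal.coe_ennreal_zero, sub_zero, EReal.toENNReal_coe]
    · show ((-((x.coord 0 : EReal) - (x.coord 1 : EReal))).toENNReal) = x.coord 1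
      rcases hx with h | h
      · rw [h, EReal.coe_ennreal_zero, zero_sub, neg_neg, EReal.toENNReal_coe]
      · rw [h, EReal.coe_ennreal_zero, sub_zero]
        exact EReal.toENNReal_of_nonpos (EReal.neg_le_zero.2 (EReal.coe_ennreal_nonneg _))
  right_inv y := by
    show (y.toENNReal : EReal) - ((-y).toENNReal : EReal) = y
    rcases le_total y 0 with h | h
    · rw [EReal.toENNReal_of_nonpos h, EReal.coe_toENNReal (EReal.neg_nonneg.2 h),
        EReal.coe_ennreal_zero, zero_sub, neg_neg]
    · rw [EReal.toENNReal_of_nonpos (EReal.neg_le_zero.2 h), EReal.coe_toENNReal h,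
        EReal.coe_ennreal_zero, sub_zero]

theorem coe_sub_coe_sub (b : ℝ) (y : EReal) : (b : EReal) - ((b : EReal) - y) = y := by
  induction y with
  | bot => simp
  | top => simp
  | coe y => rw [← EReal.coe_sub, ← EReal.coe_sub]; congr 1; ring

theorem coe_mul_coe_mul {r s : ℝ} (h : r * s = 1) (y : EReal) :
    (r : EReal) * ((s : EReal) * y) = y := by
  rw [← mul_assoc, ← EReal.coe_mul, h, EReal.coe_one, one_mul]

/-- The inversion `y ↦ 2 a - y` of `[-∞, ∞]` with respect to `a ∈ ℝ`. -/
def lineInversion (a : ℝ) : Equiv.Perm EReal where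
  toFun y := ((2 * a : ℝ) : EReal) - y
  invFun y := ((2 * a : ℝ) : EReal) - y
  left_inv y := coe_sub_coe_sub _ y
  right_inv y := coe_sub_coe_sub _ y

/-- The dilatation `y ↦ r y` of `[-∞, ∞]` with expansion factor `r > 0`. -/
def lineDilatation (r : {r : ℝ // 0 < r}) : Equiv.Perm EReal where
  toFun y := ((r : ℝ) : EReal) * y
  invFun y := (((r : ℝ)⁻¹ : ℝ) : EReal) * y
  left_inv y := coe_mul_coe_mul (inv_mul_cancel₀ r.2.ne') y
  right_inv y := coe_mul_coe_mul (mul_inv_cancel₀ r.2.ne') y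

/-- The inversion of the star with two legs with respect to its finite point `a ∈ ℝ`. -/
def inversion (a : ℝ) : Equiv.Perm (StarCurve 2) := lineEquiv.symm.permCongr (lineInversion a)

/-- The dilatation of the star with two legs that fixes `0` and has expansion factor `r`. -/
def dilatation (r : {r : ℝ // 0 < r}) : Equiv.Perm (StarCurve 2) :=
  lineEquiv.symm.permCongr (lineDilatation r)

end StarCurve

end TropicalStar

end

noncomputable section

namespace TropicalStar

namespace StarCurve

variable {n : ℕ}

/-! Geometry. By `IsFiniteHarmonic.bijective_and_isometric` and `isFiniteHarmonic_of_isometric`, the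
automorphisms of the star are exactly its continuous distance-preserving permutations. One that
fixes the centre preserves heights and permutes the legs (`exists_legPerm`). If the centre went to
height `t ≠ 0`, its sphere of radius `t`, with `n` points, would correspond to a sphere with two
points, so for `n ≠ 2` the centre is fixed (`map_center`) and the group is `S_n`. For `n = 2` the
finite part is the real line, and a translation brings the image of the centre back, leaving only
the identity or the inversion at `0`. Distances see nothing at infinity, where all of them are
infinite; hence most statements concern finite points, and continuity and density do the rest.

Algebra. An automorphism `g` acts by `f ↦ f ∘ g⁻¹`, and a dilatation by `r` acts by `f ↦ r f(· /
r)`, which keeps slopes integral. Together they give `homothetyHom` on the semidirect product, and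
the main point is that it is bijective.

Let `φ` be a semiring automorphism. Slopes are integers, so the nonzero infinitely divisible
elements are the constants (`eq_const_of_divisible`), and `φ` permutes the constants. The induced
map of the reals is additive, monotone and surjective, hence multiplication by some `r > 0`
(`exists_factor`); dividing by a dilatation, one may assume that `φ` fixes the constants.
Compactness of the star then shows that each `f ↦ φ f x` is evaluation at a finite point `σ x`
(`exists_point`). Along a leg, the coordinates of `σ` have integer slopes, and so do those of the
inverse point map; nonzero slopes are inverse to each other, hence `±1` (`abs_slope_le_one`). So `σ`
and its inverse do not increase distances, and `σ` agrees on finite points with an automorphism of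
the star. For `n ≠ 2` dilatations commute with leg permutations and the semidirect product is
direct. -/

/-- The point at which the legs are glued. -/
def center (n : ℕ) : StarCurve n := ⟨0, fun _ _ _ => Or.inl rfl⟩

@[simp] theorem coord_center (i : Fin n) : (center n).coord i = 0 := rfl

@[simp] theorem leg_zero_eq_center (i : Fin n) : leg i 0 = center n :=
  Subtype.ext (Pi.single_zero i)

theorem center_mem_finitePoints : center n ∈ finitePoints n := fun i => by simp

theorem leg_mem_finitePoints_iff {i : Fin n} {t : ℝ≥0∞} : leg i t ∈ finitePoints n ↔ t ≠ ⊤ :=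
  ⟨fun h => by simpa using h i, leg_mem_finitePoints i⟩

theorem dist_leg_center (i : Fin n) (t : ℝ≥0∞) : dist (leg i t) (center n) = t := by
  rw [← leg_zero_eq_center i, dist_leg_zero]

theorem leg_injective (i : Fin n) : Function.Injective (leg i) := fun s t h => by
  simpa using congrArg (fun x => coord x i) h

theorem leg_index_injective {i j : Fin n} {s t : ℝ≥0∞} (hs : s ≠ 0) (h : leg i s = leg j t) :
    i = j := by
  by_contra hij
  have := congrArg (fun x => coord x i) h
  simp [coord_leg_ne hij] at this
  exact hs this

/-! ### Distances and points at infinity -/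

theorem dist_eq_top {x y : StarCurve n} (hx : x ∉ finitePoints n) (hxy : x ≠ y) :
    dist x y = ⊤ := by
  simp only [finitePoints, mem_ofPred_eq, not_forall, not_not] at hx
  obtain ⟨i, hi⟩ := hx
  obtain rfl : x = leg i ⊤ := by rw [← hi]; exact eq_leg (by simp [hi])
  obtain ⟨j, t, rfl⟩ := exists_leg i.pos y
  by_cases hij : i = j
  · subst hij
    have ht : t ≠ ⊤ := by rintro rfl; exact hxy rfl
    rw [dist_leg, ENNReal.top_sub ht, top_add]
  · rw [dist_leg_ne hij, top_add]

theorem dist_ne_top {x y : StarCurve n} (hx : x ∈ finitePoints n) (hy : y ∈ finitePoints n) :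
    dist x y ≠ ⊤ := by
  refine (ENNReal.sum_lt_top.2 fun i _ => ?_).ne
  exact ENNReal.add_lt_top.2
    ⟨tsub_le_self.trans_lt (hx i).lt_top, tsub_le_self.trans_lt (hy i).lt_top⟩

/-- Finiteness is a metric property: a finite point has another point at finite distance, which
needs at least one leg, whereas a point at infinity has none. -/
theorem mem_finitePoints_of_isometric (hn : 0 < n) {g : Equiv.Perm (StarCurve n)}
    (hd : ∀ x y, dist (g x) (g y) = dist x y) {x : StarCurve n} (hx : x ∈ finitePoints n) :
    g x ∈ finitePoints n := by
  obtain ⟨y, hy, hxy⟩ : ∃ y ∈ finitePoints n, x ≠ y := by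
    by_cases h : x = center n
    · refine ⟨leg ⟨0, hn⟩ 1, leg_mem_finitePoints _ (by simp), fun h' => ?_⟩
      rw [h, ← leg_zero_eq_center ⟨0, hn⟩] at h'
      exact zero_ne_one (leg_injective _ h')
    · exact ⟨_, center_mem_finitePoints, h⟩
  by_contra hg
  exact dist_ne_top hx hy ((hd x y).symm.trans (dist_eq_top hg (g.injective.ne hxy)))

theorem isometric_of_finitePoints {g : Equiv.Perm (StarCurve n)}
    (hg : ∀ x, g x ∈ finitePoints n ↔ x ∈ finitePoints n)
    (hd : ∀ x ∈ finitePoints n, ∀ y ∈ finitePoints n, dist (g x) (g y) = dist x y)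
    (x y : StarCurve n) : dist (g x) (g y) = dist x y := by
  by_cases hxy : x = y
  · rw [hxy, dist_self, dist_self]
  by_cases hx : x ∈ finitePoints n
  · by_cases hy : y ∈ finitePoints n
    · exact hd x hx y hy
    · rw [dist_comm, dist_comm x, dist_eq_top hy (Ne.symm hxy),
        dist_eq_top (mt (hg y).1 hy) (g.injective.ne (Ne.symm hxy))]
  · rw [dist_eq_top hx hxy, dist_eq_top (mt (hg x).1 hx) (g.injective.ne hxy)]

/-! ### Permutations of the legs -/

/-- The permutation of the legs of the star along a permutation of their indices. -/
def legPerm : Equiv.Perm (Fin n) →* Equiv.Perm (StarCurve n) where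
  toFun π :=
    { toFun := fun x => ⟨fun i => x.coord (π.symm i), fun _ _ h =>
        x.2 _ _ (π.symm.injective.ne h)⟩
      invFun := fun x => ⟨fun i => x.coord (π i), fun _ _ h => x.2 _ _ (π.injective.ne h)⟩
      left_inv := fun x => ext fun i => congrArg x.coord (π.symm_apply_apply i)
      right_inv := fun x => ext fun i => congrArg x.coord (π.apply_symm_apply i) }
  map_one' := rfl
  map_mul' _ _ := rfl

theorem coord_legPerm (π : Equiv.Perm (Fin n)) (x : StarCurve n) (i : Fin n) :
    (legPerm π x).coord i = x.coord (π.symm i) := rfl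

theorem legPerm_leg (π : Equiv.Perm (Fin n)) (i : Fin n) (t : ℝ≥0∞) :
    legPerm π (leg i t) = leg (π i) t := by
  ext j
  rw [coord_legPerm]
  by_cases h : j = π i
  · subst h; simp
  · rw [coord_leg_ne h, coord_leg_ne]
    rintro rfl
    simp at h

theorem legPerm_mem_Aut (π : Equiv.Perm (Fin n)) : legPerm π ∈ Aut n :=
  isFiniteHarmonic_of_isometric _
    (Continuous.subtype_mk (continuous_pi fun i => continuous_coord (π.symm i)) _)
    fun x y => Equiv.sum_comp π.symm
      fun i => (x.coord i - y.coord i) + (y.coord i - x.coord i)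

theorem continuous_of_mem_Aut {g : Equiv.Perm (StarCurve n)} (hg : g ∈ Aut n) : Continuous g :=
  hg.1

theorem dist_of_mem_Aut {g : Equiv.Perm (StarCurve n)} (hg : g ∈ Aut n) (x y : StarCurve n) :
    dist (g x) (g y) = dist x y :=
  IsFiniteHarmonic.bijective_and_isometric hg |>.2 x y

theorem eq_of_mem_Aut {g h : Equiv.Perm (StarCurve n)} (hg : g ∈ Aut n) (hh : h ∈ Aut n)
    (H : ∀ x ∈ finitePoints n, g x = h x) : g = h :=
  Equiv.coe_fn_injective <| Continuous.ext_on dense_finitePoints (continuous_of_mem_Aut hg)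
    (continuous_of_mem_Aut hh) H

/-- Distances tell whether two finite points away from the centre share a leg. At height `⊤` this
information is lost. -/
theorem sub_add_sub_ne_add {s t : ℝ≥0∞} (hs : s ≠ 0) (ht : t ≠ 0) (hs' : s ≠ ⊤) (ht' : t ≠ ⊤) :
    (s - t) + (t - s) ≠ s + t := by
  intro h
  rcases le_total s t with hst | hst
  · rw [tsub_eq_zero_of_le hst, zero_add] at h
    have : t - s < s + t := by
      rw [add_comm]
      exact tsub_le_self.trans_lt (ENNReal.lt_add_right ht' hs)
    exact this.ne h
  · rw [tsub_eq_zero_of_le hst, add_zero] at h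
    have : s - t < s + t := tsub_le_self.trans_lt (ENNReal.lt_add_right hs' ht)
    exact this.ne h

/-- A distance-preserving permutation that fixes the centre permutes the legs. -/
theorem exists_legPerm (hn : 0 < n) {g : Equiv.Perm (StarCurve n)}
    (hd : ∀ x y, dist (g x) (g y) = dist x y) (h0 : g (center n) = center n) :
    ∃ π : Equiv.Perm (Fin n), ∀ x ∈ finitePoints n, g x = legPerm π x := by
  have hleg : ∀ i t, ∃ j, g (leg i t) = leg j t := by
    intro i t
    obtain ⟨j, s, hs⟩ := exists_leg hn (g (leg i t))
    refine ⟨j, ?_⟩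
    have := hd (leg i t) (center n)
    rw [h0, hs, dist_leg_center, dist_leg_center] at this
    rw [hs, this]
  choose p hp using hleg
  -- The height `1` serves as reference on each leg. At height `0` the chosen leg is arbitrary, and
  -- at `⊤` the distances do not determine it.
  have hconst : ∀ i t, t ≠ 0 → t ≠ ⊤ → p i t = p i 1 := by
    intro i t ht ht'
    by_contra hne
    have := hd (leg i t) (leg i 1)
    rw [hp, hp, dist_leg_ne hne, dist_leg] at this
    exact sub_add_sub_ne_add ht one_ne_zero ht' ENNReal.one_ne_top this.symm
  have hinj : Function.Injective fun i => p i 1 := by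
    intro i j hij
    have : g (leg i 1) = g (leg j 1) := by rw [hp, hp]; exact congrArg (fun k => leg k 1) hij
    exact leg_index_injective one_ne_zero (g.injective this)
  refine ⟨Equiv.ofBijective _ (Finite.injective_iff_bijective.1 hinj), fun x hx => ?_⟩
  obtain ⟨i, t, rfl⟩ := exists_leg hn x
  rw [legPerm_leg, Equiv.ofBijective_apply]
  rcases eq_or_ne t 0 with rfl | ht
  · simpa using h0
  · rw [hp, hconst i t ht (leg_mem_finitePoints_iff.1 hx)]

theorem setOf_dist_center (hn : 0 < n) (t : ℝ≥0∞) :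
    {x : StarCurve n | dist x (center n) = t} = range fun i => leg i t := by
  ext x
  constructor
  · intro hx
    obtain ⟨i, s, rfl⟩ := exists_leg hn x
    rw [mem_ofPred_eq, dist_leg_center] at hx
    exact ⟨i, by rw [hx]⟩
  · rintro ⟨i, rfl⟩
    exact dist_leg_center i t

/-- The radius is the distance to the centre, so the sphere meets the other legs only at the centre.
It has two points for every `n`, unlike a sphere around the centre. -/
theorem setOf_dist_leg (i : Fin n) {t : ℝ≥0∞} (ht : t ≠ ⊤) :
    {x : StarCurve n | dist x (leg i t) = t} = {center n, leg i (t + t)} := by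
  ext x
  simp only [mem_ofPred_eq, mem_insert_iff, mem_singleton_iff]
  constructor
  · intro hx
    obtain ⟨j, s, rfl⟩ := exists_leg i.pos x
    by_cases hj : j = i
    · subst hj
      rw [dist_leg] at hx
      rcases le_total s t with hst | hst
      · left
        rw [tsub_eq_zero_of_le hst, zero_add] at hx
        have h1 : t - s + s = t := tsub_add_cancel_of_le hst
        rw [hx] at h1
        have : s = 0 := (ENNReal.add_right_inj ht).1 (by rw [h1, add_zero])
        rw [this, leg_zero_eq_center]
      · right
        rw [tsub_eq_zero_of_le hst, add_zero] at hx
        have h1 : s - t + t = s := tsub_add_cancel_of_le hst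
        rw [hx] at h1
        rw [h1]
    · left
      rw [dist_leg_ne hj] at hx
      have : s = 0 := (ENNReal.add_left_inj ht).1 (by rw [hx, zero_add])
      rw [this, leg_zero_eq_center]
  · rintro (rfl | rfl)
    · rw [dist_comm, dist_leg_center]
    · rw [dist_leg, ENNReal.add_sub_cancel_right ht, tsub_eq_zero_of_le le_self_add, add_zero]

/-- The centre is the only point whose small spheres have `n` points, if `n ≠ 2`. -/
theorem map_center (hn : 0 < n) (hn2 : n ≠ 2) {g : Equiv.Perm (StarCurve n)}
    (hd : ∀ x y, dist (g x) (g y) = dist x y) : g (center n) = center n := by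
  obtain ⟨i, t, ht⟩ := exists_leg hn (g (center n))
  have htop : t ≠ ⊤ := leg_mem_finitePoints_iff.1
    (ht ▸ mem_finitePoints_of_isometric hn hd center_mem_finitePoints)
  rcases eq_or_ne t 0 with rfl | ht0
  · rw [ht, leg_zero_eq_center]
  exfalso
  -- Both spheres have the same positive radius `t`; they have `n` and `2` points.
  have himg : g '' {x | dist x (center n) = t} = {x | dist x (leg i t) = t} := by
    ext y
    constructor
    · rintro ⟨x, hx, rfl⟩
      rw [mem_ofPred_eq, ← ht, hd]
      exact hx
    · intro hy
      refine ⟨g.symm y, ?_, g.apply_symm_apply y⟩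
      rw [mem_ofPred_eq, ← hd, g.apply_symm_apply, ht]
      exact hy
  have hcard := congrArg Set.ncard himg
  rw [ncard_image_of_injective _ g.injective, setOf_dist_center hn, setOf_dist_leg i htop,
    ncard_pair, ← image_univ, ncard_image_of_injective, ncard_univ, Nat.card_eq_fintype_card,
    Fintype.card_fin] at hcard
  · exact hn2 hcard
  · intro j k hjk
    exact leg_index_injective ht0 hjk
  · rw [← leg_zero_eq_center i]
    intro h
    have := leg_injective i h
    exact ht0 (add_eq_zero.1 this.symm).1

/-- The automorphisms of a star that does not have two legs are the permutations of its legs. -/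
def legPermEquiv (hn : 0 < n) (hn2 : n ≠ 2) : Equiv.Perm (Fin n) ≃* Aut n :=
  MulEquiv.ofBijective (legPerm.codRestrict (Aut n) legPerm_mem_Aut) <| by
    refine ⟨fun π π' h => ?_, fun g => ?_⟩
    · ext i
      have h1 : legPerm π = legPerm π' := congrArg Subtype.val h
      have h2 := congrArg (fun g => g (leg i 1)) h1
      simp only [legPerm_leg] at h2
      rw [leg_index_injective one_ne_zero h2]
    · obtain ⟨π, hπ⟩ := exists_legPerm hn (dist_of_mem_Aut g.2)
        (map_center hn hn2 (dist_of_mem_Aut g.2))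
      exact ⟨π, Subtype.ext (eq_of_mem_Aut (legPerm_mem_Aut π) g.2 fun x hx => (hπ x hx).symm)⟩

/-! ### Dilatations -/

/-- The dilatation of the star that fixes the centre and has expansion factor `r`. -/
def scale : {r : ℝ // 0 < r} →* Equiv.Perm (StarCurve n) :=
  MonoidHom.toHomPerm
    { toFun := fun r x => ⟨fun i => ENNReal.ofReal r * x.coord i, fun i j h =>
        (x.2 i j h).imp (fun h => mul_eq_zero_of_right _ h) fun h => mul_eq_zero_of_right _ h⟩
      map_one' := by
        funext x
        refine ext fun i => ?_
        show ENNReal.ofReal 1 * _ = x.coord i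
        simp
      map_mul' := fun r s => by
        funext x
        refine ext fun i => ?_
        show ENNReal.ofReal (r * s) * _ = ENNReal.ofReal r * (ENNReal.ofReal s * _)
        rw [ENNReal.ofReal_mul r.2.le, mul_assoc] }

theorem coord_scale (r : {r : ℝ // 0 < r}) (x : StarCurve n) (i : Fin n) :
    (scale r x).coord i = ENNReal.ofReal r * x.coord i := rfl

theorem scale_leg (r : {r : ℝ // 0 < r}) (i : Fin n) (t : ℝ≥0∞) :
    scale r (leg i t) = leg i (ENNReal.ofReal r * t) := by
  ext j
  rw [coord_scale]
  by_cases h : j = i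
  · subst h; simp
  · rw [coord_leg_ne h, coord_leg_ne h, mul_zero]

theorem continuous_scale (r : {r : ℝ // 0 < r}) : Continuous (scale r : StarCurve n → _) :=
  Continuous.subtype_mk (continuous_pi fun i =>
    (ENNReal.continuous_const_mul ENNReal.ofReal_ne_top).comp (continuous_coord i)) _

theorem scale_mem_finitePoints (r : {r : ℝ // 0 < r}) {x : StarCurve n}
    (hx : x ∈ finitePoints n) : scale r x ∈ finitePoints n := fun i => by
  rw [coord_scale]
  exact ENNReal.mul_ne_top ENNReal.ofReal_ne_top (hx i)

theorem dist_scale (r : {r : ℝ // 0 < r}) (x y : StarCurve n) :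
    dist (scale r x) (scale r y) = ENNReal.ofReal r * dist x y := by
  simp only [dist, coord_scale, Finset.mul_sum, mul_add]
  refine Finset.sum_congr rfl fun i _ => ?_
  rw [ENNReal.mul_sub fun _ _ => ENNReal.ofReal_ne_top,
    ENNReal.mul_sub fun _ _ => ENNReal.ofReal_ne_top]

/-- The expansion factors `r` and `r⁻¹` cancel, so the conjugate is again distance-preserving. -/
theorem scale_conj_mem_Aut (r : {r : ℝ // 0 < r}) {g : Equiv.Perm (StarCurve n)}
    (hg : g ∈ Aut n) : scale r * g * (scale r)⁻¹ ∈ Aut n := by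
  rw [← map_inv]
  refine isFiniteHarmonic_of_isometric _ ?_ fun x y => ?_
  · exact (continuous_scale r).comp ((continuous_of_mem_Aut hg).comp (continuous_scale _))
  · simp only [Equiv.Perm.mul_apply]
    rw [dist_scale, dist_of_mem_Aut hg, ← dist_scale, ← Equiv.Perm.mul_apply,
      ← Equiv.Perm.mul_apply, ← map_mul, mul_inv_cancel, map_one]
    rfl

/-- The action of the dilatations on the automorphisms of the star by conjugation. -/
def scaleConj (n : ℕ) : {r : ℝ // 0 < r} →* MulAut (Aut n) where
  toFun r :=
    { toFun := fun g => ⟨scale r * (g : Equiv.Perm (StarCurve n)) * (scale r)⁻¹, scale_conj_mem_Aut r g.2⟩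
      invFun := fun g => ⟨(scale r)⁻¹ * (g : Equiv.Perm (StarCurve n)) * scale r, by
        simpa using scale_conj_mem_Aut r⁻¹ g.2⟩
      left_inv := fun g => Subtype.ext (by simp [mul_assoc])
      right_inv := fun g => Subtype.ext (by simp [mul_assoc])
      map_mul' := fun g h => Subtype.ext (by simp [mul_assoc]) }
  map_one' := by ext g : 2; simp
  map_mul' r s := by ext g : 2; simp [mul_assoc]

theorem coe_scaleConj (r : {r : ℝ // 0 < r}) (g : Aut n) :
    (scaleConj n r g : Equiv.Perm (StarCurve n)) =
      scale r * (g : Equiv.Perm (StarCurve n)) * (scale r)⁻¹ := rfl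

/-- Leg permutations keep heights and dilatations keep legs, so they commute. -/
theorem scaleConj_eq_one (hn : 0 < n) (hn2 : n ≠ 2) : scaleConj n = 1 := by
  ext r g : 3
  rw [coe_scaleConj, mul_inv_eq_iff_eq_mul]
  obtain ⟨π, rfl⟩ := (legPermEquiv hn hn2).surjective g
  ext x : 1
  obtain ⟨i, t, rfl⟩ := exists_leg hn x
  show scale r (legPerm π _) = legPerm π (scale r _)
  rw [legPerm_leg, scale_leg, scale_leg, legPerm_leg]

/-! ### The automorphisms of the star with two legs -/

theorem lineEquiv_leg_zero (t : ℝ≥0∞) : lineEquiv (leg 0 t) = t := by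
  show ((leg 0 t).coord 0 : EReal) - ((leg 0 t).coord 1 : EReal) = t
  rw [coord_leg_self, coord_leg_ne (by decide)]
  simp

theorem lineEquiv_leg_one (t : ℝ≥0∞) : lineEquiv (leg 1 t) = -t := by
  show ((leg (1 : Fin 2) t).coord 0 : EReal) - ((leg (1 : Fin 2) t).coord 1 : EReal) = -t
  rw [coord_leg_self, coord_leg_ne (by decide)]
  simp

/-- The point of the star with two legs that corresponds to a real number. -/
def linePoint (y : ℝ) : StarCurve 2 := lineEquiv.symm y

theorem linePoint_injective : Function.Injective linePoint := fun y z h => by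
  simpa [linePoint] using h

theorem linePoint_of_nonneg {y : ℝ} (hy : 0 ≤ y) : linePoint y = leg 0 (ENNReal.ofReal y) := by
  rw [linePoint, Equiv.symm_apply_eq, lineEquiv_leg_zero, EReal.coe_ennreal_ofReal,
    max_eq_left hy]

theorem linePoint_of_nonpos {y : ℝ} (hy : y ≤ 0) : linePoint y = leg 1 (ENNReal.ofReal (-y)) := by
  rw [linePoint, Equiv.symm_apply_eq, lineEquiv_leg_one, EReal.coe_ennreal_ofReal,
    max_eq_left (by linarith)]
  simp

theorem linePoint_zero : linePoint 0 = center 2 := by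
  rw [linePoint_of_nonneg le_rfl]; simp

theorem linePoint_mem_finitePoints (y : ℝ) : linePoint y ∈ finitePoints 2 := by
  rcases le_total 0 y with h | h
  · rw [linePoint_of_nonneg h]; exact leg_mem_finitePoints _ (by simp)
  · rw [linePoint_of_nonpos h]; exact leg_mem_finitePoints _ (by simp)

theorem exists_linePoint {x : StarCurve 2} (hx : x ∈ finitePoints 2) : ∃ y, x = linePoint y := by
  obtain ⟨i, t, rfl⟩ := exists_leg two_pos x
  have ht := leg_mem_finitePoints_iff.1 hx
  lift t to ℝ≥0 using ht
  fin_cases i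
  · exact ⟨t, ((linePoint_of_nonneg t.2).trans (by simp)).symm⟩
  · exact ⟨-t, ((linePoint_of_nonpos (by simp)).trans (by simp)).symm⟩

theorem coord_linePoint (y : ℝ) :
    (linePoint y).coord 0 = ENNReal.ofReal y ∧ (linePoint y).coord 1 = ENNReal.ofReal (-y) := by
  rcases le_total 0 y with h | h
  · rw [linePoint_of_nonneg h, coord_leg_self, coord_leg_ne (by decide),
      ENNReal.ofReal_of_nonpos (neg_nonpos.2 h)]
    exact ⟨rfl, rfl⟩
  · rw [linePoint_of_nonpos h, coord_leg_self, coord_leg_ne (by decide),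
      ENNReal.ofReal_of_nonpos h]
    exact ⟨rfl, rfl⟩

/-- The two coordinates are the positive and the negative part of the real number, and the distances
of these parts add up to `|y - z|`. -/
theorem dist_linePoint (y z : ℝ) :
    dist (linePoint y) (linePoint z) = ENNReal.ofReal |y - z| := by
  have key : ∀ a b : ℝ, (ENNReal.ofReal a - ENNReal.ofReal b) +
      (ENNReal.ofReal b - ENNReal.ofReal a) = ENNReal.ofReal |max a 0 - max b 0| := by
    intro a b
    have hmax : ∀ c : ℝ, ENNReal.ofReal c = ENNReal.ofReal (max c 0) := fun c => by
      rw [ENNReal.ofReal_max, ENNReal.ofReal_zero, max_eq_left zero_le]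
    rw [hmax a, hmax b,
      ← ENNReal.ofReal_sub _ (le_max_right b 0), ← ENNReal.ofReal_sub _ (le_max_right a 0)]
    rcases le_total (max a 0) (max b 0) with h | h
    · rw [ENNReal.ofReal_of_nonpos (sub_nonpos.2 h), zero_add, abs_sub_comm,
        abs_of_nonneg (sub_nonneg.2 h)]
    · rw [ENNReal.ofReal_of_nonpos (sub_nonpos.2 h), add_zero, abs_of_nonneg (sub_nonneg.2 h)]
  rw [dist, Fin.sum_univ_two, (coord_linePoint y).1, (coord_linePoint y).2,
    (coord_linePoint z).1, (coord_linePoint z).2, key, key,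
    ← ENNReal.ofReal_add (abs_nonneg _) (abs_nonneg _)]
  congr 1
  rcases le_total 0 y with hy | hy <;> rcases le_total 0 z with hz | hz
  · rw [max_eq_left hy, max_eq_left hz, max_eq_right (by linarith), max_eq_right (by linarith)]
    simp
  · rw [max_eq_left hy, max_eq_right hz, max_eq_right (by linarith), max_eq_left (by linarith),
      abs_of_nonneg (by linarith), abs_of_nonpos (by linarith), abs_of_nonneg (by linarith)]
    ring
  · rw [max_eq_right hy, max_eq_left hz, max_eq_left (by linarith), max_eq_right (by linarith),
      abs_of_nonpos (by linarith), abs_of_nonneg (by linarith), abs_of_nonpos (by linarith)]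
    ring
  · rw [max_eq_right hy, max_eq_right hz, max_eq_left (by linarith), max_eq_left (by linarith),
      neg_sub_neg, abs_sub_comm z]
    simp

theorem continuous_lineEquiv_symm : Continuous lineEquiv.symm := by
  refine Continuous.subtype_mk (continuous_pi fun i => ?_) _
  fin_cases i
  · exact EReal.continuous_toENNReal
  · exact EReal.continuous_toENNReal.comp continuous_neg

/-- Subtraction on `EReal` is not jointly continuous, so the continuity comes from the inverse, a
continuous bijection from a compact to a Hausdorff space. -/
theorem continuous_lineEquiv : Continuous lineEquiv :=
  Continuous.continuous_symm_of_equiv_compact_to_t2 (f := lineEquiv.symm)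
    continuous_lineEquiv_symm

/-! ### Inversions and translations of the line -/

theorem permCongr_mem_Aut (h : Equiv.Perm EReal) (u : ℝ → ℝ) (hc : Continuous h)
    (hu : ∀ y : ℝ, h y = u y) (hd : ∀ y z, |u y - u z| = |y - z|)
    (hfin : ∀ y : EReal, (∃ a : ℝ, h y = a) → ∃ b : ℝ, y = b) :
    lineEquiv.symm.permCongr h ∈ Aut 2 := by
  have hval : ∀ y : ℝ, lineEquiv.symm.permCongr h (linePoint y) = linePoint (u y) := by
    intro y
    simp [Equiv.permCongr_apply, linePoint, hu]
  refine isFiniteHarmonic_of_isometric _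
    (continuous_lineEquiv_symm.comp (hc.comp continuous_lineEquiv))
    (isometric_of_finitePoints (fun x => ⟨fun hx => ?_, fun hx => ?_⟩) fun x hx y hy => ?_)
  · obtain ⟨a, ha⟩ := exists_linePoint hx
    obtain ⟨b, hb⟩ := hfin (lineEquiv x) ⟨a, by
      simpa [Equiv.permCongr_apply, linePoint] using ha⟩
    obtain rfl : x = linePoint b := by rw [linePoint, ← hb, Equiv.symm_apply_apply]
    exact linePoint_mem_finitePoints b
  · obtain ⟨y, rfl⟩ := exists_linePoint hx
    rw [hval]
    exact linePoint_mem_finitePoints _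
  · obtain ⟨y, rfl⟩ := exists_linePoint hx
    obtain ⟨z, rfl⟩ := exists_linePoint hy
    rw [hval, hval, dist_linePoint, dist_linePoint, hd]

theorem inversion_linePoint (a y : ℝ) : inversion a (linePoint y) = linePoint (2 * a - y) := by
  simp [inversion, Equiv.permCongr_apply, linePoint, lineInversion]

theorem inversion_mem_Aut (a : ℝ) : inversion a ∈ Aut 2 := by
  refine permCongr_mem_Aut _ (fun y => 2 * a - y) ?_ (fun y => rfl) (fun y z => ?_) ?_
  · show Continuous fun y : EReal => ((2 * a : ℝ) : EReal) - y
    simp only [sub_eq_add_neg]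
    refine continuous_iff_continuousAt.2 fun y => ?_
    exact ContinuousAt.comp (f := fun y : EReal => (((2 * a : ℝ) : EReal), -y))
      (g := fun p : EReal × EReal => p.1 + p.2)
      (EReal.continuousAt_add (Or.inl (EReal.coe_ne_top _)) (Or.inl (EReal.coe_ne_bot _)))
      (continuous_const.prodMk continuous_neg).continuousAt
  · rw [abs_sub_comm]; congr 1; ring
  · rintro y ⟨b, hb⟩
    refine ⟨2 * a - b, ?_⟩
    have := coe_sub_coe_sub (2 * a) y
    rw [← this, show ((2 * a : ℝ) : EReal) - y = b from hb]
    rfl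

theorem inversion_mul_self (a : ℝ) : inversion a * inversion a = 1 :=
  eq_of_mem_Aut (mul_mem (inversion_mem_Aut a) (inversion_mem_Aut a)) (one_mem _) fun x hx => by
    obtain ⟨y, rfl⟩ := exists_linePoint hx
    simp [inversion_linePoint]

theorem inversion_inv (a : ℝ) : (inversion a)⁻¹ = inversion a :=
  inv_eq_of_mul_eq_one_left (inversion_mul_self a)

/-- The translation of the star with two legs by a real number. -/
def translation : Multiplicative ℝ →* Aut 2 where
  -- `2 (a / 2) - (0 - y) = a + y`: a translation is a product of two inversions.
  toFun a := ⟨inversion (a.toAdd / 2) * inversion 0,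
    mul_mem (inversion_mem_Aut _) (inversion_mem_Aut _)⟩
  map_one' := Subtype.ext (by simp [inversion_mul_self])
  map_mul' a b := Subtype.ext <| eq_of_mem_Aut
    (mul_mem (inversion_mem_Aut _) (inversion_mem_Aut _))
    (mul_mem (mul_mem (inversion_mem_Aut _) (inversion_mem_Aut _))
      (mul_mem (inversion_mem_Aut _) (inversion_mem_Aut _))) fun x hx => by
    obtain ⟨y, rfl⟩ := exists_linePoint hx
    show (inversion _ * inversion 0) _ = (inversion _ * inversion 0 * (inversion _ * inversion 0)) _
    simp only [Equiv.Perm.mul_apply, inversion_linePoint, toAdd_mul]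
    congr 1
    ring

theorem coe_translation (a : Multiplicative ℝ) :
    (translation a : Equiv.Perm (StarCurve 2)) = inversion (a.toAdd / 2) * inversion 0 := rfl

theorem translation_linePoint (a : Multiplicative ℝ) (y : ℝ) :
    (translation a : Equiv.Perm (StarCurve 2)) (linePoint y) = linePoint (a.toAdd + y) := by
  rw [coe_translation, Equiv.Perm.mul_apply, inversion_linePoint, inversion_linePoint]
  congr 1
  ring

/-- A distance-preserving permutation of the star with two legs that fixes the centre is the
identity or the inversion with respect to the centre, up to its values at infinity. -/
theorem eqOn_one_or_inversion {g : Equiv.Perm (StarCurve 2)}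
    (hd : ∀ x y, dist (g x) (g y) = dist x y) (h0 : g (center 2) = center 2) :
    ∃ h : Equiv.Perm (StarCurve 2), (h = 1 ∨ h = inversion 0) ∧
      ∀ x ∈ finitePoints 2, g x = h x := by
  obtain ⟨π, hπ⟩ := exists_legPerm two_pos hd h0
  have hπ2 : π = 1 ∨ π = Equiv.swap 0 1 := by
    clear * -
    revert π
    decide
  rcases hπ2 with rfl | rfl
  · exact ⟨1, Or.inl rfl, fun x hx => by rw [hπ x hx, map_one]⟩
  · refine ⟨_, Or.inr rfl, fun x hx => ?_⟩
    rw [hπ x hx]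
    obtain ⟨y, rfl⟩ := exists_linePoint hx
    rw [inversion_linePoint]
    rcases le_total 0 y with h | h
    · rw [linePoint_of_nonneg h, linePoint_of_nonpos (by linarith), legPerm_leg,
        Equiv.swap_apply_left]
      simp
    · rw [linePoint_of_nonpos h, linePoint_of_nonneg (by linarith), legPerm_leg,
        Equiv.swap_apply_right]
      simp

/-- Translating the image of the centre back to the centre reduces to the case of a fixed centre.
Only finite points are controlled, since `g` need not be continuous. -/
theorem exists_translation_mul {g : Equiv.Perm (StarCurve 2)}
    (hd : ∀ x y, dist (g x) (g y) = dist x y) :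
    ∃ (a : Multiplicative ℝ) (h : Equiv.Perm (StarCurve 2)), (h = 1 ∨ h = inversion 0) ∧
      ∀ x ∈ finitePoints 2, g x = ((translation a : Equiv.Perm (StarCurve 2)) * h) x := by
  obtain ⟨b, hb⟩ :=
    exists_linePoint (mem_finitePoints_of_isometric two_pos hd center_mem_finitePoints)
  let a : Multiplicative ℝ := Multiplicative.ofAdd b
  let T : Equiv.Perm (StarCurve 2) := translation a
  obtain ⟨h, hh, hgh⟩ := eqOn_one_or_inversion (g := T⁻¹ * g)
    (fun x y => by
      rw [Equiv.Perm.mul_apply, Equiv.Perm.mul_apply, dist_of_mem_Aut (inv_mem (translation a).2),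
        hd])
    (by
      rw [Equiv.Perm.mul_apply, Equiv.Perm.inv_eq_iff_eq, hb, ← linePoint_zero,
        translation_linePoint]
      simp [a])
  refine ⟨a, h, hh, fun x hx => ?_⟩
  rw [Equiv.Perm.mul_apply, ← hgh x hx, Equiv.Perm.mul_apply]
  exact (T.apply_symm_apply (g x)).symm

theorem exists_translation_mul_eq (g : Aut 2) :
    ∃ (a : Multiplicative ℝ) (h : Equiv.Perm (StarCurve 2)), (h = 1 ∨ h = inversion 0) ∧
      (g : Equiv.Perm (StarCurve 2)) = (translation a : Equiv.Perm (StarCurve 2)) * h := by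
  obtain ⟨a, h, hh, H⟩ := exists_translation_mul (dist_of_mem_Aut g.2)
  refine ⟨a, h, hh, eq_of_mem_Aut g.2 (mul_mem (translation a).2 ?_) H⟩
  rcases hh with rfl | rfl
  · exact one_mem _
  · exact inversion_mem_Aut 0

theorem Aut_two_eq_closure : Aut 2 = Subgroup.closure (range inversion) := by
  refine le_antisymm (fun g hg => ?_) ?_
  · obtain ⟨a, h, hh, H⟩ := exists_translation_mul_eq ⟨g, hg⟩
    have hmem : ∀ b, inversion b ∈ Subgroup.closure (range inversion) := fun b =>
      Subgroup.subset_closure ⟨b, rfl⟩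
    obtain rfl : g = _ := H
    rw [coe_translation]
    refine mul_mem (mul_mem (hmem _) (hmem _)) ?_
    rcases hh with rfl | rfl
    · exact one_mem _
    · exact hmem 0
  · rw [Subgroup.closure_le]
    rintro _ ⟨a, rfl⟩
    exact inversion_mem_Aut a

/-- A distance-preserving permutation may permute the points at infinity arbitrarily; this corrects
it there. It is meant for the point map of a semiring automorphism, which is only known at finite
points. -/
theorem exists_mem_Aut_eqOn {n : ℕ} (hn : 0 < n) {g : Equiv.Perm (StarCurve n)}
    (hd : ∀ x y, dist (g x) (g y) = dist x y) :
    ∃ h ∈ Aut n, ∀ x ∈ finitePoints n, g x = h x := by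
  by_cases hn2 : n = 2
  · subst hn2
    obtain ⟨a, h, hh, H⟩ := exists_translation_mul hd
    refine ⟨_, mul_mem (translation a).2 ?_, H⟩
    rcases hh with rfl | rfl
    · exact one_mem _
    · exact inversion_mem_Aut 0
  · obtain ⟨π, hπ⟩ := exists_legPerm hn hd (map_center hn hn2 hd)
    exact ⟨_, legPerm_mem_Aut π, hπ⟩

theorem inversion_ne_one : inversion 0 ≠ 1 := fun h => by
  have := congrArg (fun g => g (linePoint 1)) h
  simp only [inversion_linePoint, Equiv.Perm.one_apply] at this
  have := linePoint_injective this
  norm_num at this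

theorem eq_one_or_inversion (h : Subgroup.zpowers (inversion 0)) :
    (h : Equiv.Perm (StarCurve 2)) = 1 ∨ (h : Equiv.Perm (StarCurve 2)) = inversion 0 := by
  obtain ⟨_, k, rfl⟩ := h
  rcases Int.even_or_odd' k with ⟨m, rfl | rfl⟩
  · left
    show inversion 0 ^ (2 * m) = 1
    rw [zpow_mul, zpow_ofNat, pow_two, inversion_mul_self, one_zpow]
  · right
    show inversion 0 ^ (2 * m + 1) = inversion 0
    rw [zpow_add, zpow_mul, zpow_ofNat, pow_two, inversion_mul_self, one_zpow, one_mul, zpow_one]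

open scoped Classical in
/-- The action of the inversion with respect to the centre on the translations. -/
def inversionAction : Subgroup.zpowers (inversion 0) →* MulAut (Multiplicative ℝ) where
  toFun h := if h = 1 then 1 else MulEquiv.inv _
  map_one' := if_pos rfl
  map_mul' h k := by
    -- The group has exactly two elements, so multiplicativity is a check of four cases.
    have hι : ∀ h : Subgroup.zpowers (inversion 0), h = 1 ∨
        h = ⟨inversion 0, Subgroup.mem_zpowers _⟩ := fun h =>
      (eq_one_or_inversion h).imp (fun h => Subtype.ext h) fun h => Subtype.ext h
    have hne : (⟨inversion 0, Subgroup.mem_zpowers _⟩ : Subgroup.zpowers (inversion 0)) ≠ 1 :=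
      fun h => inversion_ne_one (congrArg Subtype.val h)
    have hmul : (⟨inversion 0, Subgroup.mem_zpowers _⟩ : Subgroup.zpowers (inversion 0)) *
        ⟨inversion 0, Subgroup.mem_zpowers _⟩ = 1 := Subtype.ext (inversion_mul_self 0)
    rcases hι h with rfl | rfl <;> rcases hι k with rfl | rfl
    · simp
    · simp
    · simp
    · rw [hmul, if_pos rfl, if_neg hne]
      ext a : 1
      simp

theorem inversionAction_inversion (a : Multiplicative ℝ) :
    inversionAction ⟨inversion 0, Subgroup.mem_zpowers _⟩ a = a⁻¹ := by
  have hne : (⟨inversion 0, Subgroup.mem_zpowers _⟩ : Subgroup.zpowers (inversion 0)) ≠ 1 :=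
    fun h => inversion_ne_one (congrArg Subtype.val h)
  rw [inversionAction, MonoidHom.coe_mk, OneHom.coe_mk, if_neg hne]
  rfl

theorem zpowers_inversion_le : Subgroup.zpowers (inversion 0) ≤ Aut 2 :=
  Subgroup.zpowers_le.2 (inversion_mem_Aut 0)

/-- The automorphisms of the star with two legs are the isometries of the real line. -/
def autTwoEquiv :
    Multiplicative ℝ ⋊[inversionAction] Subgroup.zpowers (inversion 0) ≃* Aut 2 :=
  MulEquiv.ofBijective
    (SemidirectProduct.lift translation (Subgroup.inclusion zpowers_inversion_le) (by
      -- Compatibility of the two factors: conjugating the translation by `a` with the inversion at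
      -- `0` gives the translation by `-a`.
      intro h
      refine MonoidHom.ext fun a => Subtype.ext ?_
      rcases eq_one_or_inversion h with hh | hh
      · obtain rfl : h = 1 := Subtype.ext hh
        simp
      · obtain rfl : h = ⟨inversion 0, Subgroup.mem_zpowers _⟩ := Subtype.ext hh
        simp only [MonoidHom.comp_apply, MulEquiv.coe_toMonoidHom, inversionAction_inversion,
          MulAut.conj_apply]
        refine eq_of_mem_Aut (translation _).2 (mul_mem (mul_mem (inversion_mem_Aut 0)
          (translation a).2) (inv_mem (inversion_mem_Aut 0))) fun x hx => ?_
        obtain ⟨y, rfl⟩ := exists_linePoint hx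
        show _ = (inversion 0 * (translation a : Equiv.Perm (StarCurve 2)) * (inversion 0)⁻¹) _
        rw [inversion_inv, Equiv.Perm.mul_apply, Equiv.Perm.mul_apply, inversion_linePoint,
          translation_linePoint, translation_linePoint, inversion_linePoint, toAdd_inv]
        congr 1
        ring)) <| by
    constructor
    · rw [injective_iff_map_eq_one]
      rintro ⟨a, h⟩ hah
      have H : (translation a : Equiv.Perm (StarCurve 2)) * (h : Equiv.Perm (StarCurve 2)) = 1 :=
        congrArg Subtype.val hah
      -- The second factor fixes the real number `0`, so evaluation there reads off the translation.
      have ha : a = 1 := by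
        have h0 : (h : Equiv.Perm (StarCurve 2)) (linePoint 0) = linePoint 0 := by
          rcases eq_one_or_inversion h with hh | hh
          · rw [hh]; rfl
          · rw [hh, inversion_linePoint]; simp
        have h1 := congrArg (fun g => g (linePoint 0)) H
        simp only [Equiv.Perm.mul_apply, h0, translation_linePoint, Equiv.Perm.one_apply,
          add_zero] at h1
        exact linePoint_injective h1
      subst ha
      rw [map_one] at H
      have hh : h = 1 := Subtype.ext (by simpa using H)
      rw [hh]
      rfl
    · intro g
      obtain ⟨a, h, hh, H⟩ := exists_translation_mul_eq g
      have hmem : h ∈ Subgroup.zpowers (inversion 0) := by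
        rcases hh with rfl | rfl
        · exact one_mem _
        · exact Subgroup.mem_zpowers _
      exact ⟨⟨a, ⟨h, hmem⟩⟩, Subtype.ext H.symm⟩

theorem dilatation_eq_scale (r : {r : ℝ // 0 < r}) : dilatation r = scale r := by
  ext x : 1
  obtain ⟨i, t, rfl⟩ := exists_leg two_pos x
  rw [scale_leg]
  have h : lineEquiv (dilatation r (leg i t)) = ((r : ℝ) : EReal) * lineEquiv (leg i t) := by
    simp [dilatation, Equiv.permCongr_apply, lineDilatation]
  apply lineEquiv.injective
  rw [h]
  fin_cases i
  · show _ * lineEquiv (leg 0 t) = lineEquiv (leg 0 _)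
    rw [lineEquiv_leg_zero, lineEquiv_leg_zero, EReal.coe_ennreal_mul,
      EReal.coe_ennreal_ofReal, max_eq_left r.2.le]
  · show _ * lineEquiv (leg 1 t) = lineEquiv (leg 1 _)
    rw [lineEquiv_leg_one, lineEquiv_leg_one, EReal.coe_ennreal_mul,
      EReal.coe_ennreal_ofReal, max_eq_left r.2.le, mul_neg]

end StarCurve

open StarCurve

/-! ### Pull-back of rational functions -/

/-- `h` is affine with an integer slope on each of finitely many intervals that cover `S`. -/
def PiecewiseAffineOn (h : ℝ≥0 → EReal) (S : Set ℝ≥0) : Prop :=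
  ∃ P : Set (Set ℝ≥0), P.Finite ∧ S ⊆ ⋃₀ P ∧
    ∀ I ∈ P, I.OrdConnected ∧ ∃ (m : ℤ) (c : ℝ), ∀ t ∈ I, h t = ((m * t + c : ℝ) : EReal)

theorem PiecewiseAffineOn.union {h : ℝ≥0 → EReal} {S T : Set ℝ≥0}
    (hS : PiecewiseAffineOn h S) (hT : PiecewiseAffineOn h T) :
    PiecewiseAffineOn h (S ∪ T) := by
  obtain ⟨P, hP, hPS, hPa⟩ := hS
  obtain ⟨Q, hQ, hQT, hQa⟩ := hT
  refine ⟨P ∪ Q, hP.union hQ, ?_, fun I hI => hI.elim (hPa I) (hQa I)⟩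
  rw [sUnion_union]
  exact union_subset_union hPS hQT

/-- The substitution `u` has slope `k / r`, and the outer factor `r` cancels the denominator, so a
slope `m` of `f` becomes the integer `m * k`. -/
theorem PiecewiseAffineOn.comp {f h : ℝ≥0 → EReal} {J : Set ℝ≥0} (hJ : J.OrdConnected)
    (hf : PiecewiseAffineOn f univ) {r : ℝ} (hr : 0 < r) {u : ℝ≥0 → ℝ≥0} {k : ℤ} {b : ℝ}
    (hu : ∀ t ∈ J, r * u t = k * t + b) (hh : ∀ t ∈ J, h t = (r : EReal) * f (u t)) :
    PiecewiseAffineOn h J := by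
  obtain ⟨P, hP, hPu, hPa⟩ := hf
  refine ⟨(fun I => J ∩ u ⁻¹' I) '' P, hP.image _, fun t ht => ?_, ?_⟩
  · obtain ⟨I, hI, hIt⟩ := hPu (mem_univ (u t))
    exact ⟨_, ⟨I, hI, rfl⟩, ht, hIt⟩
  · rintro _ ⟨I, hI, rfl⟩
    obtain ⟨hIo, m, c, hm⟩ := hPa I hI
    refine ⟨⟨fun s hs t ht w hw => ?_⟩, m * k, m * b + r * c, fun t ht => ?_⟩
    · have hwJ := hJ.out hs.1 ht.1 hw
      -- `u` is monotone or antitone on `J` according to the sign of `k`; the unordered interval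
      -- covers both cases.
      refine ⟨hwJ, hIo.uIcc_subset hs.2 ht.2 ?_⟩
      have h1 := hu s hs.1
      have h2 := hu t ht.1
      have h3 := hu w hwJ
      have hw1 : (s : ℝ) ≤ w := hw.1
      have hw2 : (w : ℝ) ≤ t := hw.2
      rw [mem_uIcc]
      rcases le_total 0 (k : ℝ) with hk | hk
      · left
        constructor <;> rw [← NNReal.coe_le_coe] <;> refine le_of_mul_le_mul_left ?_ hr <;>
          nlinarith
      · right
        constructor <;> rw [← NNReal.coe_le_coe] <;> refine le_of_mul_le_mul_left ?_ hr <;>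
          nlinarith
    · rw [hh t ht.1, hm _ ht.2, ← EReal.coe_mul]
      congr 1
      have := hu t ht.1
      push_cast
      linear_combination (m : ℝ) * this

variable {n : ℕ}

theorem mul_ne_bot_and_ne_top {r : ℝ} {y : EReal} (hy : y ≠ ⊥ ∧ y ≠ ⊤) :
    (r : EReal) * y ≠ ⊥ ∧ (r : EReal) * y ≠ ⊤ := by
  lift y to ℝ using ⟨hy.2, hy.1⟩
  rw [← EReal.coe_mul]
  exact ⟨EReal.coe_ne_bot _, EReal.coe_ne_top _⟩

theorem continuous_coe_mul {r : ℝ} (hr : r ≠ 0) : Continuous fun y : EReal => (r : EReal) * y :=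
  continuous_iff_continuousAt.2 fun y =>
    ContinuousAt.comp (f := fun y : EReal => ((r : EReal), y))
      (g := fun p : EReal × EReal => p.1 * p.2)
      (EReal.continuousAt_mul (Or.inl (by simpa using hr)) (Or.inl (by simpa using hr))
        (Or.inl (EReal.coe_ne_bot r)) (Or.inl (EReal.coe_ne_top r)))
      (continuous_const.prodMk continuous_id).continuousAt

theorem IsRational.rescale {f : StarCurve n → EReal} (hf : IsRational f) {r : ℝ} (hr : 0 < r)
    {g : StarCurve n → StarCurve n} (hg : Continuous g)
    (hfin : ∀ x ∈ finitePoints n, g x ∈ finitePoints n)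
    (hleg : (∀ i, PiecewiseAffineOn (fun t => f (leg i t)) univ) →
      ∀ i, PiecewiseAffineOn (fun t => (r : EReal) * f (g (leg i t))) univ) :
    IsRational fun x => (r : EReal) * f (g x) := by
  refine ⟨(continuous_coe_mul hr.ne').comp (hf.1.comp hg), ?_⟩
  rcases hf.2 with h | ⟨h1, h2⟩
  · refine Or.inl fun x => ?_
    show (r : EReal) * f (g x) = ⊥
    rw [h, EReal.coe_mul_bot_of_pos hr]
  · refine Or.inr ⟨fun x hx => mul_ne_bot_and_ne_top (h1 _ (hfin x hx)), fun i => ?_⟩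
    obtain ⟨P, hP, hPu, hPa⟩ := hleg (fun i => by
      obtain ⟨P, hP, hPu, hPa⟩ := h2 i
      exact ⟨P, hP, hPu.ge, hPa⟩) i
    exact ⟨P, hP, univ_subset_iff.1 hPu, hPa⟩

/-- Stretching the star by `r` divides the slopes by `r`, and multiplying the values by `r` restores
them. -/
theorem IsRational.scale {f : StarCurve n → EReal} (hf : IsRational f) (r : {r : ℝ // 0 < r}) :
    IsRational fun x => ((r : ℝ) : EReal) * f (scale r⁻¹ x) := by
  refine hf.rescale r.2 (continuous_scale _) (fun x => scale_mem_finitePoints _) fun H i => ?_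
  have hr := r.2
  refine (H i).comp ordConnected_univ hr (u := fun t => (r⁻¹ : ℝ).toNNReal * t) (k := 1) (b := 0)
    (fun t _ => ?_) fun t _ => ?_
  · rw [NNReal.coe_mul, Real.coe_toNNReal _ (by positivity)]
    field_simp
    simp
  · rw [scale_leg, ENNReal.coe_mul]
    rfl

theorem IsRational.legPerm {f : StarCurve n → EReal} (hf : IsRational f)
    (π : Equiv.Perm (Fin n)) : IsRational fun x => f (legPerm π x) := by
  have := hf.rescale one_pos (continuous_of_mem_Aut (legPerm_mem_Aut π))
    (fun x hx i => hx (π.symm i)) fun H i =>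
      (H (π i)).comp ordConnected_univ one_pos (u := id) (k := 1) (b := 0)
        (fun t _ => by simp) fun t _ => by rw [legPerm_leg]; rfl
  simpa using this

theorem inversion_mem_finitePoints (a : ℝ) {x : StarCurve 2} (hx : x ∈ finitePoints 2) :
    inversion a x ∈ finitePoints 2 :=
  mem_finitePoints_of_isometric two_pos (dist_of_mem_Aut (inversion_mem_Aut a)) hx

/-- Each leg is cut where `2 * a - y` changes sign. On each side the inversion maps into a single
leg with slope `±1`; one side may be empty. -/
theorem IsRational.inversion {f : StarCurve 2 → EReal} (hf : IsRational f) (a : ℝ) :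
    IsRational fun x => f (inversion a x) := by
  have := hf.rescale one_pos (continuous_of_mem_Aut (inversion_mem_Aut a))
    (fun x hx => inversion_mem_finitePoints a hx) fun H i => ?_
  · simpa using this
  have hmul : ∀ y : EReal, ((1 : ℝ) : EReal) * y = y := by simp
  have hco : ∀ y : ℝ, ENNReal.ofReal y = (y.toNNReal : ℝ≥0∞) := fun _ => rfl
  fin_cases i
  · have h0 : ∀ t : ℝ≥0, leg (0 : Fin 2) (t : ℝ≥0∞) = linePoint t := fun t =>
      ((linePoint_of_nonneg t.2).trans (by simp)).symm
    have h1 : PiecewiseAffineOn (fun t => ((1 : ℝ) : EReal) * f (StarCurve.inversion a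
        (leg (0 : Fin 2) t))) {t | (t : ℝ) ≤ 2 * a} := by
      refine (H 0).comp ⟨fun s _ t ht w hw => ?_⟩ one_pos (u := fun t => (2 * a - t).toNNReal)
        (k := -1) (b := 2 * a) (fun t ht => ?_) fun t ht => ?_
      · exact le_trans (NNReal.coe_le_coe.2 hw.2) ht
      · rw [Real.coe_toNNReal _ (sub_nonneg.2 ht)]
        push_cast
        ring
      · rw [h0, inversion_linePoint, linePoint_of_nonneg (sub_nonneg.2 ht), hco]
    have h2 : PiecewiseAffineOn (fun t => ((1 : ℝ) : EReal) * f (StarCurve.inversion a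
        (leg (0 : Fin 2) t))) {t | 2 * a ≤ (t : ℝ)} := by
      refine (H 1).comp ⟨fun s hs t _ w hw => ?_⟩ one_pos (u := fun t => (t - 2 * a).toNNReal)
        (k := 1) (b := -(2 * a)) (fun t ht => ?_) fun t ht => ?_
      · exact le_trans hs (NNReal.coe_le_coe.2 hw.1)
      · rw [Real.coe_toNNReal _ (sub_nonneg.2 ht)]
        push_cast
        ring
      · rw [h0, inversion_linePoint, linePoint_of_nonpos (sub_nonpos.2 ht), neg_sub, hco]
    have h3 := h1.union h2
    rwa [show {t : ℝ≥0 | (t : ℝ) ≤ 2 * a} ∪ {t | 2 * a ≤ (t : ℝ)} = univ from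
      eq_univ_of_forall fun t => le_total (t : ℝ) _] at h3
  -- Here `-t` goes to `2 * a + t`, which is on leg `0` as soon as `t ≥ -(2 * a)`.
  · have h0 : ∀ t : ℝ≥0, leg (1 : Fin 2) (t : ℝ≥0∞) = linePoint (-t) := fun t =>
      ((linePoint_of_nonpos (by simp)).trans (by simp)).symm
    have h1 : PiecewiseAffineOn (fun t => ((1 : ℝ) : EReal) * f (StarCurve.inversion a
        (leg (1 : Fin 2) t))) {t | (t : ℝ) ≤ -(2 * a)} := by
      refine (H 1).comp ⟨fun s _ t ht w hw => ?_⟩ one_pos (u := fun t => (-(2 * a) - t).toNNReal)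
        (k := -1) (b := -(2 * a)) (fun t ht => ?_) fun t ht => ?_
      · exact le_trans (NNReal.coe_le_coe.2 hw.2) ht
      · rw [Real.coe_toNNReal _ (sub_nonneg.2 ht)]
        push_cast
        ring
      · rw [mem_ofPred_eq] at ht
        rw [h0, inversion_linePoint, linePoint_of_nonpos (by linarith), hco]
        ring_nf
    have h2 : PiecewiseAffineOn (fun t => ((1 : ℝ) : EReal) * f (StarCurve.inversion a
        (leg (1 : Fin 2) t))) {t | -(2 * a) ≤ (t : ℝ)} := by
      refine (H 0).comp ⟨fun s hs t _ w hw => ?_⟩ one_pos (u := fun t => (t + 2 * a).toNNReal)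
        (k := 1) (b := 2 * a) (fun t ht => ?_) fun t ht => ?_
      · exact le_trans hs (NNReal.coe_le_coe.2 hw.1)
      · rw [mem_ofPred_eq] at ht
        rw [Real.coe_toNNReal _ (by linarith)]
        push_cast
        ring
      · rw [mem_ofPred_eq] at ht
        rw [h0, inversion_linePoint, linePoint_of_nonneg (by linarith), hco]
        ring_nf
    have h3 := h1.union h2
    rwa [show {t : ℝ≥0 | (t : ℝ) ≤ -(2 * a)} ∪ {t | -(2 * a) ≤ (t : ℝ)} = univ from
      eq_univ_of_forall fun t => le_total (t : ℝ) _] at h3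

/-- An automorphism is a product of at most three inversions if `n = 2`, and a leg permutation
otherwise. -/
theorem IsRational.comp_aut {f : StarCurve n → EReal} (hf : IsRational f) (hn : 0 < n)
    {g : Equiv.Perm (StarCurve n)} (hg : g ∈ Aut n) : IsRational fun x => f (g x) := by
  by_cases hn2 : n = 2
  · subst hn2
    obtain ⟨a, h, hh, H⟩ := exists_translation_mul_eq ⟨g, hg⟩
    obtain rfl : g = _ := H
    have h1 := (hf.inversion (a.toAdd / 2)).inversion 0
    rcases hh with rfl | rfl
    · exact h1
    · exact h1.inversion 0
  · obtain ⟨π, hπ⟩ := (legPermEquiv hn hn2).surjective ⟨g, hg⟩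
    obtain rfl : StarCurve.legPerm π = g := congrArg Subtype.val hπ
    exact hf.legPerm π

/-! ### Semiring automorphisms induced by automorphisms and dilatations -/

namespace RatFun

theorem coe_mul_max {r : ℝ} (hr : 0 ≤ r) (y z : EReal) :
    (r : EReal) * max y z = max ((r : EReal) * y) ((r : EReal) * z) :=
  Monotone.map_max fun _ _ h => mul_le_mul_of_nonneg_left h (EReal.coe_nonneg.2 hr)

/-- The semiring automorphism `f ↦ r f ∘ g`. -/
def rescale (r : {r : ℝ // 0 < r}) (g : Equiv.Perm (StarCurve n))
    (hfin : ∀ x ∈ finitePoints n, g x ∈ finitePoints n)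
    (h : ∀ f : StarCurve n → EReal, IsRational f →
      IsRational fun x => ((r : ℝ) : EReal) * f (g x))
    (h' : ∀ f : StarCurve n → EReal, IsRational f →
      IsRational fun x => (((r⁻¹ : {r : ℝ // 0 < r}) : ℝ) : EReal) * f (g⁻¹ x)) :
    RingAut (RatFun n) where
  toFun f := ⟨_, h f f.2⟩
  invFun f := ⟨_, h' f f.2⟩
  left_inv f := Subtype.ext <| funext fun x => by
    show _ * (_ * f (g (g⁻¹ x))) = f x
    rw [coe_mul_coe_mul (by rw [← Positive.val_mul, inv_mul_cancel]; rfl)]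
    exact congrArg f (g.apply_symm_apply x)
  right_inv f := Subtype.ext <| funext fun x => by
    show _ * (_ * f (g⁻¹ (g x))) = f x
    rw [coe_mul_coe_mul (by rw [← Positive.val_mul, mul_inv_cancel]; rfl)]
    exact congrArg f (g.symm_apply_apply x)
  map_add' f f' := Subtype.ext <| funext fun x => coe_mul_max r.2.le _ _
  map_mul' f f' := eq_of_finitePoints fun x hx => by
    refine Eq.trans ?_ (mul_apply (⟨_, h f f.2⟩ : RatFun n) (⟨_, h f' f'.2⟩ : RatFun n) hx).symm
    show ((r : ℝ) : EReal) * (f * f') (g x) =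
      ((r : ℝ) : EReal) * f (g x) + ((r : ℝ) : EReal) * f' (g x)
    rw [mul_apply _ _ (hfin x hx)]
    exact EReal.left_distrib_of_nonneg_of_ne_top (EReal.coe_nonneg.2 r.2.le)
      (EReal.coe_ne_top _) _ _

theorem ringAut_ext {φ ψ : RingAut (RatFun n)}
    (h : ∀ f, ∀ x ∈ finitePoints n, φ f x = ψ f x) : φ = ψ :=
  RingEquiv.ext fun f => eq_of_finitePoints (h f)

/-- The action of the automorphisms of the star on the rational functions. -/
def autHom (hn : 0 < n) : Aut n →* RingAut (RatFun n) where
  -- Pull-back reverses composition; the inverse makes this a homomorphism.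
  toFun g := rescale 1 (g⁻¹ : Aut n)
    (fun _ hx => mem_finitePoints_of_isometric hn (dist_of_mem_Aut (g⁻¹ : Aut n).2) hx)
    (fun f hf => by simpa using hf.comp_aut hn (g⁻¹ : Aut n).2)
    (fun f hf => by simpa using hf.comp_aut hn g.2)
  map_one' := ringAut_ext fun f x _ => one_mul (f x)
  map_mul' g h := ringAut_ext fun f x _ => by
    show ((1 : ℝ) : EReal) * f (((g * h)⁻¹ : Aut n).1 x) =
      ((1 : ℝ) : EReal) * (((1 : ℝ) : EReal) * f ((h⁻¹ : Aut n).1 ((g⁻¹ : Aut n).1 x)))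
    rw [mul_inv_rev]
    simp

theorem autHom_apply (hn : 0 < n) (g : Aut n) (f : RatFun n) (x : StarCurve n) :
    autHom hn g f x = f ((g⁻¹ : Aut n).1 x) := one_mul (f ((g⁻¹ : Aut n).1 x))

/-- The action of the dilatations on the rational functions. -/
def scaleHom (n : ℕ) : {r : ℝ // 0 < r} →* RingAut (RatFun n) where
  toFun r := rescale r (scale r⁻¹) (fun _ hx => scale_mem_finitePoints _ hx)
    (fun f hf => hf.scale r) (fun f hf => by simpa using hf.scale r⁻¹)
  map_one' := ringAut_ext fun f x _ => by
    show ((1 : ℝ) : EReal) * f (scale 1⁻¹ x) = f x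
    simp
  map_mul' r s := ringAut_ext fun f x _ => by
    show ((r * s : ℝ) : EReal) * f (scale (r * s)⁻¹ x) =
      ((r : ℝ) : EReal) * (((s : ℝ) : EReal) * f (scale s⁻¹ (scale r⁻¹ x)))
    rw [EReal.coe_mul, mul_assoc, mul_inv_rev, map_mul]
    rfl

theorem scaleHom_apply (r : {r : ℝ // 0 < r}) (f : RatFun n) (x : StarCurve n) :
    scaleHom n r f x = ((r : ℝ) : EReal) * f (scale r⁻¹ x) := rfl

/-- The action of the automorphisms and the dilatations of the star on the rational functions. -/
def homothetyHom (hn : 0 < n) : Aut n ⋊[scaleConj n] {r : ℝ // 0 < r} →* RingAut (RatFun n) :=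
  SemidirectProduct.lift (autHom hn) (scaleHom n) fun r => by
    refine MonoidHom.ext fun g => ?_
    -- The condition for the two actions to combine on the semidirect product.
    show autHom hn (scaleConj n r g) = scaleHom n r * autHom hn g * (scaleHom n r)⁻¹
    rw [eq_mul_inv_iff_mul_eq]
    refine ringAut_ext fun f x _ => ?_
    show autHom hn (scaleConj n r g) (scaleHom n r f) x = scaleHom n r (autHom hn g f) x
    rw [autHom_apply, scaleHom_apply, scaleHom_apply, autHom_apply]
    congr 2
    have : ((scaleConj n r g)⁻¹ : Aut n).1 = scale r * (g⁻¹ : Aut n).1 * (scale r)⁻¹ := by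
      rw [Subgroup.coe_inv, coe_scaleConj]
      simp [mul_assoc]
    rw [this, map_inv, ← Equiv.Perm.mul_apply, ← Equiv.Perm.mul_apply]
    simp [mul_assoc]

theorem homothetyHom_apply (hn : 0 < n) (g : Aut n) (r : {r : ℝ // 0 < r}) :
    homothetyHom hn ⟨g, r⟩ = autHom hn g * scaleHom n r := rfl

/-! ### Constants, inverses and coordinates -/

/-- A rational function is `⊥` everywhere or finite at every finite point, so one finite point
decides. -/
theorem ne_zero_iff {f : RatFun n} : f ≠ 0 ↔ f (center n) ≠ ⊥ := by
  refine ⟨fun h => ?_, fun h hf => h (by rw [hf]; rfl)⟩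
  rcases f.2.2 with hf | ⟨hf, -⟩
  · exact absurd (Subtype.ext (funext hf)) h
  · exact (hf _ center_mem_finitePoints).1

theorem ne_bot_and_ne_top {f : RatFun n} (hf : f ≠ 0) {x : StarCurve n}
    (hx : x ∈ finitePoints n) : f x ≠ ⊥ ∧ f x ≠ ⊤ := by
  rcases f.2.2 with h | ⟨h, -⟩
  · exact absurd (h _) (ne_zero_iff.1 hf)
  · exact h x hx

/-- The value of a nonzero rational function at a finite point, as a real number. -/
def val (f : RatFun n) (x : StarCurve n) : ℝ := (f x).toReal

theorem coe_val {f : RatFun n} (hf : f ≠ 0) {x : StarCurve n} (hx : x ∈ finitePoints n) :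
    (val f x : EReal) = f x :=
  EReal.coe_toReal (ne_bot_and_ne_top hf hx).2 (ne_bot_and_ne_top hf hx).1

theorem mul_ne_zero' {f g : RatFun n} (hf : f ≠ 0) (hg : g ≠ 0) : f * g ≠ 0 := by
  rw [ne_zero_iff, mul_apply _ _ center_mem_finitePoints, Ne, EReal.add_eq_bot_iff, not_or]
  exact ⟨ne_zero_iff.1 hf, ne_zero_iff.1 hg⟩

theorem val_mul {f g : RatFun n} (hf : f ≠ 0) (hg : g ≠ 0) {x : StarCurve n}
    (hx : x ∈ finitePoints n) : val (f * g) x = val f x + val g x := by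
  rw [val, mul_apply _ _ hx, ← coe_val hf hx, ← coe_val hg hx, ← EReal.coe_add,
    EReal.toReal_coe]

theorem one_ne_zero' : (1 : RatFun n) ≠ 0 := by
  rw [ne_zero_iff, one_apply]; simp

theorem pow_ne_zero' {f : RatFun n} (hf : f ≠ 0) (N : ℕ) : f ^ N ≠ 0 := by
  induction N with
  | zero => rw [pow_zero]; exact one_ne_zero'
  | succ N ih => rw [pow_succ]; exact mul_ne_zero' ih hf

theorem val_pow {f : RatFun n} (hf : f ≠ 0) {x : StarCurve n} (hx : x ∈ finitePoints n) (N : ℕ) :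
    val (f ^ N) x = N * val f x := by
  induction N with
  | zero => rw [pow_zero, val, one_apply]; simp
  | succ N ih =>
    rw [pow_succ, val_mul (pow_ne_zero' hf N) hf hx, ih]
    push_cast
    ring

theorem eq_of_val {f g : RatFun n} (hf : f ≠ 0) (hg : g ≠ 0)
    (h : ∀ x ∈ finitePoints n, val f x = val g x) : f = g :=
  eq_of_finitePoints fun x hx => by rw [← coe_val hf hx, ← coe_val hg hx, h x hx]

/-- The constant function with value `c`. -/
def const (n : ℕ) (c : ℝ) : RatFun n := ⟨fun _ => c, isRational_const _ (EReal.coe_ne_top c)⟩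

theorem const_apply (c : ℝ) (x : StarCurve n) : const n c x = c := rfl

theorem val_const (c : ℝ) (x : StarCurve n) : val (const n c) x = c := rfl

theorem const_ne_zero (c : ℝ) : const n c ≠ 0 := by
  rw [ne_zero_iff, const_apply]; simp

theorem const_injective : Function.Injective (const n) := fun _ _ h =>
  congrArg (fun f => val f (center n)) h

theorem const_mul_const (a b : ℝ) : const n a * const n b = const n (a + b) :=
  eq_of_val (mul_ne_zero' (const_ne_zero a) (const_ne_zero b)) (const_ne_zero _) fun x hx => by
    rw [val_mul (const_ne_zero a) (const_ne_zero b) hx]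
    rfl

theorem const_add_const (a b : ℝ) : const n a + const n b = const n (max a b) :=
  Subtype.ext <| funext fun _ => (EReal.coe_strictMono.monotone.map_max (a := a) (b := b)).symm

theorem const_pow (c : ℝ) {N : ℕ} : const n c ^ N = const n (N * c) :=
  eq_of_val (pow_ne_zero' (const_ne_zero c) N) (const_ne_zero _) fun x hx => by
    rw [val_pow (const_ne_zero c) hx]
    rfl

/-- This is the multiplicative inverse of `f`; it serves to reverse inequalities between values. -/
theorem exists_neg {f : RatFun n} (hf : f ≠ 0) : ∃ g : RatFun n, ∀ x, g x = -f x := by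
  refine ⟨⟨fun x => -f x, ?_, Or.inr ⟨fun x hx => ?_, fun i => ?_⟩⟩, fun _ => rfl⟩
  · exact continuous_neg.comp f.continuous_coe
  · have := ne_bot_and_ne_top hf hx
    simpa [and_comm] using this
  · rcases f.2.2 with h | ⟨-, h⟩
    · exact absurd (h _) (ne_zero_iff.1 hf)
    · obtain ⟨P, hP, hPu, hPa⟩ := h i
      refine ⟨P, hP, hPu, fun I hI => ⟨(hPa I hI).1, ?_⟩⟩
      obtain ⟨-, m, c, hm⟩ := hPa I hI
      refine ⟨-m, -c, fun t ht => ?_⟩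
      show -f (leg i t) = _
      rw [show f (leg i t) = _ from hm t ht, ← EReal.coe_neg]
      congr 1
      push_cast
      ring

/-- The distance from the centre of the projection to the `i`-th leg. -/
def coordFun (i : Fin n) : RatFun n := ⟨fun x => (x.coord i : EReal), by
  refine ⟨continuous_coe_ennreal_ereal.comp (continuous_coord i), Or.inr ⟨fun x hx => ?_, ?_⟩⟩
  · exact ⟨EReal.coe_ennreal_ne_bot _, by simpa using hx i⟩
  · intro j
    refine ⟨{univ}, finite_singleton _, sUnion_singleton _, ?_⟩
    rintro I rfl
    refine ⟨ordConnected_univ, ?_⟩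
    by_cases hij : i = j
    · subst hij
      refine ⟨1, 0, fun t _ => ?_⟩
      show ((leg i (t : ℝ≥0∞)).coord i : EReal) = _
      rw [coord_leg_self, Int.cast_one, one_mul, add_zero]
      rfl
    · refine ⟨0, 0, fun t _ => ?_⟩
      show ((leg j (t : ℝ≥0∞)).coord i : EReal) = _
      rw [coord_leg_ne hij]
      simp⟩

theorem coordFun_apply (i : Fin n) (x : StarCurve n) : coordFun i x = (x.coord i : EReal) := rfl

theorem coordFun_ne_zero (i : Fin n) : coordFun i ≠ 0 := by
  rw [ne_zero_iff, coordFun_apply]; simp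

theorem val_coordFun (i : Fin n) (x : StarCurve n) : val (coordFun i) x = (x.coord i).toReal := by
  rw [val, coordFun_apply, EReal.toReal_coe_ennreal]

/-- The coordinate functions already separate all points, those at infinity included. -/
theorem eq_of_forall_apply_eq {x y : StarCurve n} (h : ∀ f : RatFun n, f x = f y) : x = y :=
  StarCurve.ext fun i => by simpa [coordFun_apply] using h (coordFun i)

/-! ### Slopes -/

/-- The restriction of a nonzero rational function to the finite part of a leg. -/
def onLeg (f : RatFun n) (i : Fin n) (t : ℝ) : ℝ := val f (leg i (ENNReal.ofReal t))

theorem leg_ofReal_mem (i : Fin n) (t : ℝ) : leg i (ENNReal.ofReal t) ∈ finitePoints n :=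
  leg_mem_finitePoints i ENNReal.ofReal_ne_top

theorem exists_leg_ofReal (hn : 0 < n) {x : StarCurve n} (hx : x ∈ finitePoints n) :
    ∃ i t, 0 ≤ t ∧ x = leg i (ENNReal.ofReal t) := by
  obtain ⟨i, t, rfl⟩ := exists_leg hn x
  exact ⟨i, t.toReal, ENNReal.toReal_nonneg,
    by rw [ENNReal.ofReal_toReal (leg_mem_finitePoints_iff.1 hx)]⟩

theorem continuous_onLeg {f : RatFun n} (hf : f ≠ 0) (i : Fin n) : Continuous (onLeg f i) := by
  refine EReal.continuousOn_toReal.comp_continuous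
    (f := fun t => f (leg i (ENNReal.ofReal t)))
    (f.continuous_coe.comp ((continuous_leg i).comp ENNReal.continuous_ofReal)) fun t => ?_
  have := ne_bot_and_ne_top hf (leg_ofReal_mem i t)
  simpa using this

/-- `u` is affine with slope `m` immediately to the right of `t`. -/
def HasRightSlope (u : ℝ → ℝ) (m t : ℝ) : Prop := ∃ c : ℝ, ∀ᶠ s in 𝓝[>] t, u s = m * s + c

theorem exists_hasRightSlope {f : RatFun n} (hf : f ≠ 0) (i : Fin n) {t : ℝ} (ht : 0 ≤ t) :
    ∃ m : ℤ, HasRightSlope (onLeg f i) m t := by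
  rcases f.2.2 with h | ⟨-, h⟩
  · exact absurd (h _) (ne_zero_iff.1 hf)
  obtain ⟨P, hP, hPu, hPa⟩ := h i
  -- Among finitely many pieces, one is met arbitrarily close to the right of `t`; being
  -- order-connected, it contains a whole right neighbourhood.
  obtain ⟨I, hI, hfreq⟩ : ∃ I ∈ P, ∃ᶠ s : ℝ in 𝓝[>] t, s.toNNReal ∈ I := by
    by_contra! hne
    have h1 : ∀ᶠ s : ℝ in 𝓝[>] t, ∀ I ∈ P, s.toNNReal ∉ I :=
      (eventually_all_finite hP).2 fun I hI => by simpa using hne I hI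
    obtain ⟨s, hs⟩ := h1.exists
    obtain ⟨I, hI, hsI⟩ : s.toNNReal ∈ ⋃₀ P := hPu ▸ mem_univ _
    exact hs I hI hsI
  obtain ⟨hIo, m, c, hm⟩ := hPa I hI
  refine ⟨m, c, ?_⟩
  obtain ⟨s₀, hs₀I, hs₀⟩ := (hfreq.and_eventually self_mem_nhdsWithin).exists
  filter_upwards [Ioo_mem_nhdsGT hs₀] with s hs
  obtain ⟨s₁, hs₁I, hs₁⟩ := (hfreq.and_eventually (Ioo_mem_nhdsGT hs.1)).exists
  have hsI : s.toNNReal ∈ I := hIo.out hs₁I hs₀I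
    ⟨Real.toNNReal_le_toNNReal hs₁.2.le, Real.toNNReal_le_toNNReal hs.2.le⟩
  have h1 : f (leg i (ENNReal.ofReal s)) = _ := hm _ hsI
  rw [onLeg, val, h1, EReal.toReal_coe, Real.coe_toNNReal _ (ht.trans hs.1.le)]

theorem HasRightSlope.unique {u : ℝ → ℝ} {m m' t : ℝ} (h : HasRightSlope u m t)
    (h' : HasRightSlope u m' t) : m = m' := by
  obtain ⟨c, hc⟩ := h
  obtain ⟨c', hc'⟩ := h'
  obtain ⟨s, hs, hsub⟩ := (mem_nhdsGT_iff_exists_Ioo_subset).1 (hc.and hc')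
  have hs : t < s := hs
  have h1 := hsub (show t + (s - t) / 3 ∈ Ioo t s by constructor <;> linarith)
  have h2 := hsub (show t + 2 * (s - t) / 3 ∈ Ioo t s by constructor <;> linarith)
  have h3 := h1.1.symm.trans h1.2
  have h4 := h2.1.symm.trans h2.2
  have h5 : (m - m') * ((s - t) / 3) = 0 := by linear_combination h4 - h3
  rcases mul_eq_zero.1 h5 with h | h
  · linarith
  · linarith

/-- A right slope says nothing about `u t` itself; continuity supplies that value. -/
theorem HasRightSlope.hasDerivWithinAt {u : ℝ → ℝ} (hu : Continuous u) {m t : ℝ}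
    (h : HasRightSlope u m t) : HasDerivWithinAt u m (Ici t) t := by
  obtain ⟨c, hc⟩ := h
  have hval : u t = m * t + c := by
    refine tendsto_nhds_unique (hu.continuousWithinAt (s := Ioi t)) ?_
    refine Tendsto.congr' (EventuallyEq.symm hc) ?_
    exact (Continuous.continuousWithinAt (by fun_prop) :
      ContinuousWithinAt (fun s => m * s + c) (Ioi t) t)
  rw [← hasDerivWithinAt_Ioi_iff_Ici]
  have h1 : HasDerivAt (fun s => m * s + c) m t := by
    simpa using ((hasDerivAt_id t).const_mul m).add_const c
  exact h1.hasDerivWithinAt.congr_of_eventuallyEq hc hval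

/-- The mean value inequality for right derivatives. -/
theorem abs_sub_le_of_slope_le {f : RatFun n} (hf : f ≠ 0) (i : Fin n) {C : ℝ}
    (hC : ∀ t, 0 ≤ t → ∀ m : ℤ, HasRightSlope (onLeg f i) m t → |(m : ℝ)| ≤ C) {a b : ℝ}
    (ha : 0 ≤ a) (hab : a ≤ b) : |onLeg f i b - onLeg f i a| ≤ C * (b - a) := by
  have hslope : ∀ t, ∃ m : ℝ, t ∈ Ico a b → HasRightSlope (onLeg f i) m t ∧ |m| ≤ C := by
    intro t
    by_cases ht : t ∈ Ico a b
    · obtain ⟨m, hm⟩ := exists_hasRightSlope hf i (ha.trans ht.1)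
      exact ⟨m, fun _ => ⟨hm, hC t (ha.trans ht.1) m hm⟩⟩
    · exact ⟨0, fun h => absurd h ht⟩
  choose m hm using hslope
  exact norm_image_sub_le_of_norm_deriv_right_le_segment (f := onLeg f i) (f' := m)
    (continuous_onLeg hf i).continuousOn
    (fun t ht => (hm t ht).1.hasDerivWithinAt (continuous_onLeg hf i))
    (fun t ht => (hm t ht).2) b ⟨hab, le_rfl⟩

/-- The constants are the infinitely divisible rational functions. -/
theorem eq_const_of_divisible (hn : 0 < n) {f : RatFun n} (hf : f ≠ 0)
    (hdiv : ∀ N : ℕ, ∃ g, g ^ (N + 1) = f) : ∃ c, f = const n c := by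
  have hslope : ∀ i t, 0 ≤ t → ∀ m : ℤ, HasRightSlope (onLeg f i) m t → |(m : ℝ)| ≤ 0 := by
    intro i t ht m hm
    -- A root of order `|m| + 1` has an integer slope `k` with `m = (|m| + 1) * k`, which forces `m
    -- = 0`.
    obtain ⟨g, hg⟩ := hdiv m.natAbs
    have hg0 : g ≠ 0 := by
      rintro rfl
      rw [zero_pow (Nat.succ_ne_zero _)] at hg
      exact hf hg.symm
    obtain ⟨k, c, hk⟩ := exists_hasRightSlope hg0 i ht
    have h1 : HasRightSlope (onLeg f i) (((m.natAbs + 1 : ℕ) : ℝ) * k) t := by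
      refine ⟨((m.natAbs + 1 : ℕ) : ℝ) * c, hk.mono fun s hs => ?_⟩
      rw [← hg, onLeg, val_pow hg0 (leg_ofReal_mem i s)]
      rw [onLeg] at hs
      rw [hs]
      ring
    have h2 : m = ((m.natAbs + 1 : ℕ) : ℤ) * k := by
      have := hm.unique h1
      rw [← Int.cast_natCast (R := ℝ), ← Int.cast_mul] at this
      exact Int.cast_injective this
    have h3 : m = 0 := by
      refine Int.eq_zero_of_abs_lt_dvd (Dvd.intro _ h2.symm) ?_
      rw [Int.abs_eq_natAbs]
      push_cast
      omega
    rw [h3]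
    simp
  refine ⟨val f (center n), eq_of_val hf (const_ne_zero _) fun x hx => ?_⟩
  obtain ⟨i, t, ht, rfl⟩ := exists_leg_ofReal hn hx
  have h := abs_sub_le_of_slope_le hf i (hslope i) le_rfl ht
  rw [zero_mul] at h
  have h1 := sub_eq_zero.1 (abs_nonpos_iff.1 h)
  rw [onLeg, onLeg, ENNReal.ofReal_zero, leg_zero_eq_center] at h1
  rw [h1, val_const]

/-! ### Semiring automorphisms -/

theorem map_ne_zero' {φ : RingAut (RatFun n)} {f : RatFun n} (hf : f ≠ 0) : φ f ≠ 0 :=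
  fun h => hf ((EquivLike.injective φ) (h.trans (map_zero φ).symm))

/-- Infinite divisibility is preserved by semiring automorphisms and characterises the constants
among nonzero elements. -/
theorem exists_map_const (hn : 0 < n) (φ : RingAut (RatFun n)) (c : ℝ) :
    ∃ d, φ (const n c) = const n d :=
  eq_const_of_divisible hn (map_ne_zero' (const_ne_zero c)) fun N =>
    ⟨φ (const n (c / (N + 1 : ℕ))), by
      rw [← map_pow, const_pow, mul_div_cancel₀ _ (by positivity)]⟩

/-- On constants, the product gives additivity of `ρ` and the tropical sum gives monotonicity. A
monotone surjection of the reals is continuous, and a continuous additive map is linear. -/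
theorem exists_factor (hn : 0 < n) (φ : RingAut (RatFun n)) :
    ∃ r : {r : ℝ // 0 < r}, ∀ c, φ (const n c) = const n (r * c) := by
  choose ρ hρ using exists_map_const hn φ
  choose ρ' hρ' using exists_map_const hn φ.symm
  have hadd : ∀ a b, ρ (a + b) = ρ a + ρ b := fun a b => const_injective (n := n) <| by
    rw [← hρ, ← const_mul_const, map_mul, hρ, hρ, const_mul_const]
  have hmono : Monotone ρ := fun a b hab => by
    have h1 : const n (max (ρ a) (ρ b)) = const n (ρ b) := by
      rw [← const_add_const, ← hρ, ← hρ, ← map_add, const_add_const, max_eq_right hab]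
    have := const_injective h1
    exact max_eq_right_iff.1 this
  have hsurj : Function.Surjective ρ := fun b => ⟨ρ' b, const_injective (n := n) <| by
    rw [← hρ, ← hρ', RingEquiv.apply_symm_apply]⟩
  have hcont : Continuous ρ := hmono.continuous_of_surjective hsurj
  let L := (AddMonoidHom.mk' ρ hadd).toRealLinearMap hcont
  have hL : ∀ c, ρ c = ρ 1 * c := fun c => by
    have h1 : L (c • (1 : ℝ)) = c • L 1 := L.map_smul c 1
    rw [smul_eq_mul, mul_one, smul_eq_mul] at h1
    rw [mul_comm]
    exact h1
  have hpos : 0 < ρ 1 := by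
    obtain ⟨a, ha⟩ := hsurj 1
    rw [hL] at ha
    have h0 : ρ 0 ≤ ρ 1 := hmono zero_le_one
    rw [hL 0, mul_zero] at h0
    refine h0.lt_of_ne fun h => ?_
    rw [← h, zero_mul] at ha
    exact zero_ne_one ha
  exact ⟨⟨ρ 1, hpos⟩, fun c => by rw [hρ, hL]⟩

/-- A semiring automorphism that fixes the constants is the pull-back along a map of points. -/
theorem exists_point (φ : RingAut (RatFun n)) (hφ : ∀ c, φ (const n c) = const n c)
    {x : StarCurve n} (hx : x ∈ finitePoints n) :
    ∃ y ∈ finitePoints n, ∀ f, φ f x = f y := by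
  suffices h : ∃ y, ∀ f, φ f x = f y by
    obtain ⟨y, hy⟩ := h
    refine ⟨y, fun i hi => ?_, hy⟩
    -- If `y` were at infinity on leg `i`, then `φ (coordFun i)` would be infinite at the finite
    -- point `x`.
    refine (ne_bot_and_ne_top (map_ne_zero' (φ := φ) (coordFun_ne_zero i)) hx).2 ?_
    rw [hy, coordFun_apply, hi]
    rfl
  by_contra! hne
  -- Near every `y` there will be such a `g`. Since the sum is the maximum, `p` passes to finite
  -- unions, and compactness yields one `g ≥ ε` on all finite points. Bounds at finite points
  -- suffice, because these determine a rational function.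
  let p : Set (StarCurve n) → Prop := fun s => ∃ ε : ℝ, 0 < ε ∧ ∃ g : RatFun n, φ g x = 0 ∧
    ∀ z ∈ s, z ∈ finitePoints n → (ε : EReal) ≤ g z
  have key : ∀ (y : StarCurve n) (f : RatFun n), f ≠ 0 → φ f x < f y → ∃ s ∈ 𝓝 y, p s := by
    intro y f hf hlt
    have hφf := coe_val (map_ne_zero' (φ := φ) hf) hx
    set c := val (φ f) x
    rw [← hφf] at hlt
    obtain ⟨d, hcd, hd⟩ := EReal.lt_iff_exists_real_btwn.1 hlt
    refine ⟨{z | (d : EReal) < f z}, (isOpen_lt continuous_const f.continuous_coe).mem_nhds hd,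
      -- Multiplying by the constant `-c` moves the value `c` of `φ f` at `x` to `0`, as `φ` fixes
      -- constants; a real `d` strictly between `c` and `f y` leaves the margin `d - c`.
      d - c, sub_pos.2 (EReal.coe_lt_coe_iff.1 hcd), f * const n (-c), ?_, fun z hz hzfin => ?_⟩
    · rw [map_mul, hφ, mul_apply _ _ hx, ← hφf, const_apply, ← EReal.coe_add]
      simp
    · rw [mul_apply _ _ hzfin, const_apply]
      rw [mem_ofPred_eq, ← coe_val hf hzfin] at hz
      rw [← coe_val hf hzfin, ← EReal.coe_add, EReal.coe_le_coe_iff]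
      have := EReal.coe_lt_coe_iff.1 hz
      linarith
  have huniv : p univ := by
    refine isCompact_univ.induction_on (p := p) ⟨1, one_pos, 1, ?_, by simp⟩ ?_ ?_ ?_
    · rw [map_one, one_apply]
    · rintro s t hst ⟨ε, hε, g, hg, h⟩
      exact ⟨ε, hε, g, hg, fun z hz => h z (hst hz)⟩
    · rintro s t ⟨ε, hε, g, hg, h⟩ ⟨ε', hε', g', hg', h'⟩
      refine ⟨min ε ε', lt_min hε hε', g + g', ?_, fun z hz hzfin => ?_⟩
      · rw [map_add, add_apply, hg, hg', max_self]
      · rw [add_apply]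
        rcases hz with hz | hz
        · exact (EReal.coe_le_coe_iff.2 (min_le_left _ _)).trans
            ((h z hz hzfin).trans (le_max_left _ _))
        · exact (EReal.coe_le_coe_iff.2 (min_le_right _ _)).trans
            ((h' z hz hzfin).trans (le_max_right _ _))
    · intro y _
      rw [nhdsWithin_univ]
      obtain ⟨f, hfy⟩ := hne y
      have hf : f ≠ 0 := by
        rintro rfl
        exact hfy (by rw [map_zero]; rfl)
      rcases hfy.lt_or_gt with hlt | hlt
      · exact key y f hf hlt
      -- If `f y < φ f x`, the multiplicative inverse of `f` satisfies the opposite inequality.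
      · obtain ⟨g, hg⟩ := exists_neg hf
        have hg0 : g ≠ 0 := by
          rw [ne_zero_iff, hg]
          simpa using (ne_bot_and_ne_top hf center_mem_finitePoints).2
        have hfg : f * g = 1 := eq_of_finitePoints fun z hz => by
          rw [mul_apply _ _ hz, hg, ← coe_val hf hz, ← EReal.coe_neg, ← EReal.coe_add, one_apply]
          simp
        refine key y g hg0 ?_
        have h1 := congrArg (fun h => φ h x) hfg
        simp only [map_mul, map_one, one_apply] at h1
        rw [mul_apply _ _ hx, ← coe_val (map_ne_zero' hf) hx, ← coe_val (map_ne_zero' hg0) hx,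
          ← EReal.coe_add, ← EReal.coe_zero, EReal.coe_eq_coe_iff] at h1
        rw [hg, ← coe_val (map_ne_zero' hg0) hx, eq_neg_of_add_eq_zero_right h1, EReal.coe_neg,
          coe_val (map_ne_zero' hf) hx]
        exact EReal.neg_lt_neg_iff.2 hlt
  obtain ⟨ε, hε, g, hg, h⟩ := huniv
  -- Applying `φ` and evaluating at `x` turns this identity into `max ε 0 = 0`, contradicting `0 <
  -- ε`.
  have h1 : const n ε + g = g := eq_of_finitePoints fun z hz =>
    max_eq_right (h z (mem_univ z) hz)
  have h2 := congrArg (fun h => φ h x) h1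
  simp only [map_add, hφ] at h2
  rw [add_apply, hg, const_apply, max_eq_right_iff] at h2
  exact absurd (EReal.coe_nonpos.1 h2) (not_le.2 hε)

/-! ### The point map of a semiring automorphism does not increase distances -/

section PointMap

variable {φ : RingAut (RatFun n)} {σ τ : StarCurve n → StarCurve n}

/-- Where the slope `m` is not zero, `σ` maps a short interval of leg `j` affinely into leg `i`. The
inverse `τ` has slope `1 / m` there, which is also an integer. -/
theorem abs_slope_le_one (hσ : ∀ x ∈ finitePoints n, σ x ∈ finitePoints n)
    (hφ : ∀ x ∈ finitePoints n, ∀ f, φ f x = f (σ x))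
    (hψ : ∀ x ∈ finitePoints n, ∀ f, φ.symm f x = f (τ x))
    (hτσ : ∀ x ∈ finitePoints n, τ (σ x) = x) (i j : Fin n) {t : ℝ} (ht : 0 ≤ t) {m : ℤ}
    (hm : HasRightSlope (onLeg (φ (coordFun i)) j) m t) : |(m : ℝ)| ≤ 1 := by
  rcases eq_or_ne m 0 with rfl | hm0
  · simp
  have hmr : (m : ℝ) ≠ 0 := by exact_mod_cast hm0
  obtain ⟨c, hc⟩ := hm
  obtain ⟨s₀, hs₀, hsub⟩ := mem_nhdsGT_iff_exists_Ioo_subset.1 hc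
  have hs₀ : t < s₀ := hs₀
  have hval : ∀ s ∈ Ioo t s₀,
      ((σ (leg j (ENNReal.ofReal s))).coord i).toReal = m * s + c := by
    intro s hs
    rw [← val_coordFun, val, ← hφ _ (leg_ofReal_mem j s)]
    exact hsub hs
  -- Coordinates are nonnegative, and a non-constant affine function that is nonnegative on an open
  -- interval is positive there: compare with a point further down the slope.
  have hpos : ∀ s ∈ Ioo t s₀, 0 < m * s + c := by
    intro s hs
    rcases lt_or_gt_of_ne hmr with h | h
    · have h1 := hval ((s + s₀) / 2) ⟨by linarith [hs.1, hs.2], by linarith [hs.2]⟩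
      have h2 : (0 : ℝ) ≤ m * ((s + s₀) / 2) + c := h1 ▸ ENNReal.toReal_nonneg
      nlinarith [hs.2]
    · have h1 := hval ((s + t) / 2) ⟨by linarith [hs.1], by linarith [hs.1, hs.2]⟩
      have h2 : (0 : ℝ) ≤ m * ((s + t) / 2) + c := h1 ▸ ENNReal.toReal_nonneg
      nlinarith [hs.1]
  have hleg : ∀ s ∈ Ioo t s₀,
      σ (leg j (ENNReal.ofReal s)) = leg i (ENNReal.ofReal (m * s + c)) := by
    intro s hs
    have h1 : (σ (leg j (ENNReal.ofReal s))).coord i = ENNReal.ofReal (m * s + c) := by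
      rw [← hval s hs, ENNReal.ofReal_toReal (hσ _ (leg_ofReal_mem j s) i)]
    rw [← h1]
    refine eq_leg ?_
    rw [h1]
    exact (ENNReal.ofReal_pos.2 (hpos s hs)).ne'
  have hinv : ∀ s ∈ Ioo t s₀, onLeg (φ.symm (coordFun j)) i (m * s + c) = s := by
    intro s hs
    rw [onLeg, val, ← hleg s hs, hψ _ (hσ _ (leg_ofReal_mem j s)), hτσ _ (leg_ofReal_mem j s)]
    show val (coordFun j) _ = s
    rw [val_coordFun, coord_leg_self, ENNReal.toReal_ofReal (ht.trans hs.1.le)]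
  -- An interior point is needed: if `m < 0`, a right neighbourhood of the image corresponds to a
  -- left neighbourhood of `s₁`.
  let s₁ := (t + s₀) / 2
  have hs₁ : s₁ ∈ Ioo t s₀ := ⟨by simp only [s₁]; linarith, by simp only [s₁]; linarith⟩
  obtain ⟨m', hm'⟩ := exists_hasRightSlope
    (map_ne_zero' (φ := φ.symm) (coordFun_ne_zero j)) i (hpos s₁ hs₁).le
  have hslope : HasRightSlope (onLeg (φ.symm (coordFun j)) i) (1 / m) (m * s₁ + c) := by
    refine ⟨-c / m, ?_⟩
    have hcont : ContinuousAt (fun u : ℝ => (u - c) / m) (m * s₁ + c) := by fun_prop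
    have h1 : ∀ᶠ u in 𝓝 (m * s₁ + c), (u - c) / m ∈ Ioo t s₀ :=
      hcont.eventually (isOpen_Ioo.mem_nhds (by
        show (m * s₁ + c - c) / (m : ℝ) ∈ Ioo t s₀
        rw [add_sub_cancel_right, mul_div_cancel_left₀ _ hmr]; exact hs₁))
    refine (h1.filter_mono nhdsWithin_le_nhds).mono fun u hu => ?_
    have h2 := hinv _ hu
    rw [mul_div_cancel₀ _ hmr, sub_add_cancel] at h2
    rw [h2]
    ring
  have h1 : (m' : ℝ) * m = 1 := by rw [hm'.unique hslope, one_div_mul_cancel hmr]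
  have h2 : m * m' = 1 := by rw [mul_comm]; exact_mod_cast h1
  rcases Int.eq_one_or_neg_one_of_mul_eq_one h2 with rfl | rfl <;> simp

theorem dist_le_of_leg (hn : 0 < n) (hσ : ∀ x ∈ finitePoints n, σ x ∈ finitePoints n)
    (hφ : ∀ x ∈ finitePoints n, ∀ f, φ f x = f (σ x))
    (hψ : ∀ x ∈ finitePoints n, ∀ f, φ.symm f x = f (τ x))
    (hτσ : ∀ x ∈ finitePoints n, τ (σ x) = x) (j : Fin n) {s t : ℝ} (hs : 0 ≤ s) (hst : s ≤ t) :
    dist (σ (leg j (ENNReal.ofReal s))) (σ (leg j (ENNReal.ofReal t))) ≤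
      ENNReal.ofReal (t - s) := by
  let v : Fin n → ℝ → ℝ := fun i => onLeg (φ (coordFun i)) j
  have hv : ∀ i a b, 0 ≤ a → a ≤ b → |v i b - v i a| ≤ b - a := by
    intro i a b ha hab
    have := abs_sub_le_of_slope_le (map_ne_zero' (φ := φ) (coordFun_ne_zero i)) j (C := 1)
      (fun t ht m hm => abs_slope_le_one hσ hφ hψ hτσ i j ht hm) ha hab
    rwa [one_mul] at this
  have hval : ∀ i a, v i a = ((σ (leg j (ENNReal.ofReal a))).coord i).toReal := by
    intro i a
    rw [← val_coordFun, val, ← hφ _ (leg_ofReal_mem j a)]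
    rfl
  obtain ⟨i, a, ha, hia⟩ := exists_leg_ofReal hn (hσ _ (leg_ofReal_mem j s))
  obtain ⟨k, b, hb, hkb⟩ := exists_leg_ofReal hn (hσ _ (leg_ofReal_mem j t))
  have hvis : v i s = a := by rw [hval, hia, coord_leg_self, ENNReal.toReal_ofReal ha]
  have hvkt : v k t = b := by rw [hval, hkb, coord_leg_self, ENNReal.toReal_ofReal hb]
  rw [hia, hkb]
  by_cases hik : i = k
  · subst hik
    have h1 := abs_le.1 (hv i s t hs hst)
    rw [hvis, hvkt] at h1
    rw [dist_leg, ← ENNReal.ofReal_sub _ hb, ← ENNReal.ofReal_sub _ ha]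
    rcases le_total a b with h | h
    · rw [ENNReal.ofReal_of_nonpos (sub_nonpos.2 h), zero_add]
      exact ENNReal.ofReal_le_ofReal (by linarith)
    · rw [ENNReal.ofReal_of_nonpos (sub_nonpos.2 h), add_zero]
      exact ENNReal.ofReal_le_ofReal (by linarith)
  · have hvit : v i t = 0 := by rw [hval, hkb, coord_leg_ne hik, ENNReal.toReal_zero]
    have hvks : v k s = 0 := by rw [hval, hia, coord_leg_ne (Ne.symm hik), ENNReal.toReal_zero]
    have hcont : ∀ i, Continuous (v i) := fun i =>
      continuous_onLeg (map_ne_zero' (coordFun_ne_zero i)) j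
    -- To change legs, the image must pass through a point where coordinates `i` and `k` agree. At
    -- most one of them is nonzero, so both vanish; then `a ≤ u - s` and `b ≤ t - u`.
    obtain ⟨u, hu, huv⟩ : ∃ u ∈ Icc s t, v i u - v k u = 0 := by
      refine intermediate_value_Icc' hst ((hcont i).sub (hcont k)).continuousOn ⟨?_, ?_⟩
      · show v i t - v k t ≤ 0
        rw [hvit, hvkt]; linarith
      · show 0 ≤ v i s - v k s
        rw [hvis, hvks]; linarith
    have hviu : v i u = 0 ∧ v k u = 0 := by
      rcases (σ (leg j (ENNReal.ofReal u))).2 i k hik with h | h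
      · have : v i u = 0 := by rw [hval, coord, h, ENNReal.toReal_zero]
        exact ⟨this, by linarith⟩
      · have : v k u = 0 := by rw [hval, coord, h, ENNReal.toReal_zero]
        exact ⟨by linarith, this⟩
    have h1 := abs_le.1 (hv i s u hs hu.1)
    have h2 := abs_le.1 (hv k u t (hs.trans hu.1) hu.2)
    rw [hvis, hviu.1] at h1
    rw [hvkt, hviu.2] at h2
    rw [dist_leg_ne hik, ← ENNReal.ofReal_add ha hb]
    exact ENNReal.ofReal_le_ofReal (by linarith)

/-- Points on different legs are compared through the centre, where the triangle inequality in the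
source is an equality. -/
theorem dist_pointMap_le (hn : 0 < n) (hσ : ∀ x ∈ finitePoints n, σ x ∈ finitePoints n)
    (hφ : ∀ x ∈ finitePoints n, ∀ f, φ f x = f (σ x))
    (hψ : ∀ x ∈ finitePoints n, ∀ f, φ.symm f x = f (τ x))
    (hτσ : ∀ x ∈ finitePoints n, τ (σ x) = x) {x y : StarCurve n}
    (hx : x ∈ finitePoints n) (hy : y ∈ finitePoints n) : dist (σ x) (σ y) ≤ dist x y := by
  have hle : ∀ (j : Fin n) {s t : ℝ}, 0 ≤ s → s ≤ t →
      dist (σ (leg j (ENNReal.ofReal s))) (σ (leg j (ENNReal.ofReal t))) ≤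
        dist (leg j (ENNReal.ofReal s)) (leg j (ENNReal.ofReal t)) := by
    intro j s t hs hst
    refine (dist_le_of_leg hn hσ hφ hψ hτσ j hs hst).trans ?_
    rw [dist_leg, ← ENNReal.ofReal_sub _ hs]
    exact le_add_self
  obtain ⟨i, s, hs, rfl⟩ := exists_leg_ofReal hn hx
  obtain ⟨j, t, ht, rfl⟩ := exists_leg_ofReal hn hy
  by_cases hij : i = j
  · subst hij
    rcases le_total s t with hst | hst
    · exact hle i hs hst
    · rw [dist_comm, dist_comm (leg i _)]
      exact hle i ht hst
  · have h1 := hle i le_rfl hs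
    have h2 := hle j le_rfl ht
    rw [ENNReal.ofReal_zero, leg_zero_eq_center, dist_comm (center n), dist_leg_center,
      dist_comm] at h1
    rw [ENNReal.ofReal_zero, leg_zero_eq_center, dist_comm (center n), dist_leg_center] at h2
    rw [dist_leg_ne hij]
    exact (dist_triangle _ (σ (center n)) _).trans (add_le_add h1 h2)

end PointMap

/-! ### Semiring automorphisms are homotheties -/

theorem exists_autHom_eq (hn : 0 < n) (φ : RingAut (RatFun n))
    (hφ : ∀ c, φ (const n c) = const n c) : ∃ g, autHom hn g = φ := by
  classical
  have hψ : ∀ c, φ.symm (const n c) = const n c := fun c => by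
    rw [RingEquiv.symm_apply_eq, hφ]
  have : Nonempty (StarCurve n) := ⟨center n⟩
  choose! σ hσ hφσ using fun x (hx : x ∈ finitePoints n) => exists_point φ hφ hx
  choose! τ hτ hψτ using fun x (hx : x ∈ finitePoints n) => exists_point φ.symm hψ hx
  have hτσ : ∀ x ∈ finitePoints n, τ (σ x) = x := fun x hx =>
    eq_of_forall_apply_eq fun f => by
      rw [← hψτ _ (hσ x hx), ← hφσ x hx, RingEquiv.apply_symm_apply]
  have hστ : ∀ x ∈ finitePoints n, σ (τ x) = x := fun x hx =>
    eq_of_forall_apply_eq fun f => by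
      rw [← hφσ _ (hτ x hx), ← hψτ x hx, RingEquiv.symm_apply_apply]
  let g : Equiv.Perm (StarCurve n) :=
    { toFun := fun x => if x ∈ finitePoints n then σ x else x
      invFun := fun x => if x ∈ finitePoints n then τ x else x
      left_inv := fun x => by
        by_cases hx : x ∈ finitePoints n
        · simp [hx, hσ x hx, hτσ x hx]
        · simp [hx]
      right_inv := fun x => by
        by_cases hx : x ∈ finitePoints n
        · simp [hx, hτ x hx, hστ x hx]
        · simp [hx] }
  have hg : ∀ x ∈ finitePoints n, g x = σ x := fun x hx => if_pos hx
  have hg' : ∀ x, x ∉ finitePoints n → g x = x := fun x hx => if_neg hx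
  have hfin : ∀ x, g x ∈ finitePoints n ↔ x ∈ finitePoints n := by
    intro x
    by_cases hx : x ∈ finitePoints n
    · simp only [hg x hx, hσ x hx, hx]
    · simp only [hg' x hx]
  have hd := isometric_of_finitePoints hfin fun x hx y hy => by
    rw [hg x hx, hg y hy]
    refine le_antisymm (dist_pointMap_le hn hσ hφσ hψτ hτσ hx hy) ?_
    have := dist_pointMap_le (φ := φ.symm) hn hτ hψτ hφσ hστ (hσ x hx) (hσ y hy)
    rwa [hτσ x hx, hτσ y hy] at this
  obtain ⟨h, hh, H⟩ := exists_mem_Aut_eqOn hn hd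
  refine ⟨⟨h, hh⟩⁻¹, ringAut_ext fun f x hx => ?_⟩
  rw [autHom_apply, inv_inv, hφσ x hx, ← hg x hx, H x hx]

theorem scaleHom_const (r : {r : ℝ // 0 < r}) (c : ℝ) :
    scaleHom n r (const n c) = const n (r * c) :=
  Subtype.ext <| funext fun _ => (EReal.coe_mul r c).symm

/-- Every semiring automorphism is induced by a unique homothety of the star. -/
theorem homothetyHom_bijective (hn : 0 < n) : Function.Bijective (homothetyHom hn) := by
  constructor
  · rw [injective_iff_map_eq_one]
    rintro ⟨g, r⟩ h
    rw [homothetyHom_apply] at h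
    -- Automorphisms of the star fix constants, so the image of the constant `1` reads off `r`.
    have hr : r = 1 := by
      have h1 := congrArg (fun φ : RingAut (RatFun n) => φ (const n 1)) h
      have h2 : autHom hn g (scaleHom n r (const n 1)) = const n 1 := h1
      have h3 := congrArg (fun f => val f (center n)) h2
      simp only [scaleHom_const, val, autHom_apply, const_apply, EReal.toReal_coe, mul_one] at h3
      exact Subtype.ext h3
    subst hr
    rw [map_one, mul_one] at h
    have hg : g⁻¹ = 1 := by
      refine Subtype.ext (Equiv.ext fun x => eq_of_forall_apply_eq fun f => ?_)
      show f ((g⁻¹ : Aut n).1 x) = f x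
      rw [← autHom_apply hn, h]
      rfl
    rw [inv_eq_one.1 hg]
    rfl
  · intro φ
    obtain ⟨r, hr⟩ := exists_factor hn φ
    -- After division by the dilatation that matches `φ` on constants, the constants are fixed.
    obtain ⟨g, hg⟩ := exists_autHom_eq hn (φ * scaleHom n r⁻¹) fun c => by
      show φ (scaleHom n r⁻¹ (const n c)) = const n c
      rw [scaleHom_const, hr, ← mul_assoc, ← Positive.val_mul, mul_inv_cancel]
      simp
    refine ⟨⟨g, r⟩, ?_⟩
    rw [homothetyHom_apply, hg, mul_assoc, ← map_mul, inv_mul_cancel, map_one, mul_one]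

/-- The group of semiring automorphisms is the group of homotheties of the star. -/
def homothetyEquiv (hn : 0 < n) :
    Aut n ⋊[scaleConj n] {r : ℝ // 0 < r} ≃* RingAut (RatFun n) :=
  MulEquiv.ofBijective (homothetyHom hn) (homothetyHom_bijective hn)

end RatFun

end TropicalStar

theorem proposition2 :
    (∀ n : ℕ, 1 ≤ n → n ≠ 2 →
      Nonempty (TropicalStar.StarCurve.Aut n ≃* Equiv.Perm (Fin n)) ∧
      Nonempty (RingAut (TropicalStar.RatFun n) ≃*
        TropicalStar.StarCurve.Aut n × {r : ℝ // 0 < r})) ∧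
    (TropicalStar.StarCurve.Aut 2 =
        Subgroup.closure (Set.range TropicalStar.StarCurve.inversion) ∧
      (∃ φ : Subgroup.zpowers (TropicalStar.StarCurve.inversion 0) →*
            MulAut (Multiplicative ℝ),
        (∀ a : Multiplicative ℝ,
          φ ⟨TropicalStar.StarCurve.inversion 0, Subgroup.mem_zpowers _⟩ a = a⁻¹) ∧
        Nonempty (TropicalStar.StarCurve.Aut 2 ≃*
          Multiplicative ℝ ⋊[φ] Subgroup.zpowers (TropicalStar.StarCurve.inversion 0))) ∧
      (∃ φ : {r : ℝ // 0 < r} →* MulAut (TropicalStar.StarCurve.Aut 2),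
        (∀ (r : {r : ℝ // 0 < r}) (g : TropicalStar.StarCurve.Aut 2),
          (φ r g : Equiv.Perm (TropicalStar.StarCurve 2)) =
            TropicalStar.StarCurve.dilatation r * g *
              (TropicalStar.StarCurve.dilatation r)⁻¹) ∧
        Nonempty (RingAut (TropicalStar.RatFun 2) ≃*
          TropicalStar.StarCurve.Aut 2 ⋊[φ] {r : ℝ // 0 < r}))) := by
  refine ⟨fun n hn hn2 => ⟨⟨(TropicalStar.StarCurve.legPermEquiv hn hn2).symm⟩, ⟨?_⟩⟩,
    TropicalStar.StarCurve.Aut_two_eq_closure,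
    ⟨TropicalStar.StarCurve.inversionAction, TropicalStar.StarCurve.inversionAction_inversion,
      ⟨TropicalStar.StarCurve.autTwoEquiv.symm⟩⟩,
    ⟨TropicalStar.StarCurve.scaleConj 2, fun r g => ?_,
      ⟨(TropicalStar.RatFun.homothetyEquiv two_pos).symm⟩⟩⟩
  · have e := (TropicalStar.RatFun.homothetyEquiv hn).symm
    -- With trivial action the semidirect product is the direct product.
    rw [TropicalStar.StarCurve.scaleConj_eq_one hn hn2] at e
    exact e.trans SemidirectProduct.mulEquivProd
  · rw [TropicalStar.StarCurve.coe_scaleConj, TropicalStar.StarCurve.dilatation_eq_scale]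

end
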